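/- Let $n\ge 1$, $1<p<\infty$, $p'=p/(p-1)$, and let $\gamma$ be real with $\gamma>0$ if $p\le n$, $2\gamma\ge p-n$ if $p>n$, and $2\gamma+n\ge 2$ (the last condition is automatic for $n\ge 2$). Let $q\in L_{\gamma+n/2}(\mathbb{R}^n)$ be complex-valued and let $q=ab$ be a factorization into measurable functions with $$M_{\nu,p'}(a)<\infty,\quad 0<\nu<p',\qquad M_{\mu,p}(b)<\infty,\quad 0<\mu<p,$$ where $M_{\nu,s}(u)=\sup_{x}\int_{|x-y|<1}|u(y)|^{s}|x-y|^{\nu-n}\,dy$. Let $H$ be the corresponding Schrödinger operator $-\Delta+q$ in $L_p(\mathbb{R}^n)$: its domain consists of those $u\in L_p(\mathbb{R}^n)$ for which $bu\in L_p(\mathbb{R}^n)$, $a(bu)$ is locally integrable, and the distribution $-\Delta u+a(bu)$ belongs to $L_p(\mathbb{R}^n)$, and $Hu=-\Delta u+a(bu)$. Then every eigenvalue $\lambda$ of $H$ with $\operatorname{Re}\lambda<0$, written $\lambda=|\lambda|e^{i(\pi-\theta)}$ with $-\pi/2<\theta<\pi/2$, satisfies $$|\lambda|^{\gamma}\le C(n,\gamma,\theta)\int_{\mathbb{R}^n}|q(x)|^{\gamma+n/2}\,dx,$$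 $$C(n,\gamma,\theta)=\frac{1}{(4\pi)^{n/2}\cos^{2\gamma}\theta}\left(\frac{2\gamma+n-2}{2\gamma+n}\right)^{n(2\gamma+n-2)/4}\Gamma\!\left(\frac{2\gamma}{2\gamma+n}\right)^{\gamma+n/2},$$ where $0^0=1$ (this case occurs only for $n=1$, $\gamma=1/2$). -/

import Mathlib

open MeasureTheory
open scoped ENNReal ContDiff Laplacian

noncomputable section

/-- The quantity `M_{ν,s}(u) = sup_x ∫_{|x-y|<1} |u(y)|^s |x-y|^{ν-n} dy` (with values in
`[0,∞]`) that defines the Stummel classes on `ℝⁿ`. -/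
def stummelM {n : ℕ} (ν s : ℝ) (u : EuclideanSpace ℝ (Fin n) → ℂ) : ℝ≥0∞ :=
  ⨆ x : EuclideanSpace ℝ (Fin n),
    ∫⁻ y in Metric.ball x 1, ‖u y‖ₑ ^ s * ‖x - y‖ₑ ^ (ν - n)

/-- The complex Banach space `L_p(ℝⁿ)`, for a real exponent `p`. -/
abbrev LpC (n : ℕ) (p : ℝ) : Type :=
  Lp ℂ (ENNReal.ofReal p) (volume : Measure (EuclideanSpace ℝ (Fin n)))

/-- `a b u` is locally integrable and `-Δ u + a (b u) = f` in the sense of distributions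
on `ℝⁿ`. -/
def IsWeakSchrodinger {n : ℕ} (a b u f : EuclideanSpace ℝ (Fin n) → ℂ) : Prop :=
  LocallyIntegrable (fun x => a x * (b x * u x)) ∧
  ∀ φ : EuclideanSpace ℝ (Fin n) → ℂ, ContDiff ℝ ∞ φ → HasCompactSupport φ →
    -(∫ x, u x * Δ φ x) + ∫ x, (a x * (b x * u x)) * φ x = ∫ x, f x * φ x

theorem integrable_mul_test {n : ℕ} {g φ : EuclideanSpace ℝ (Fin n) → ℂ}
    (hg : LocallyIntegrable g) (hφ : Continuous φ) (hc : HasCompactSupport φ) :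
    Integrable (fun x => g x * φ x) := by
  have h := hg.integrable_smul_right_of_hasCompactSupport hφ hc
  simpa [smul_eq_mul] using h

theorem continuous_laplacian_test {n : ℕ} {φ : EuclideanSpace ℝ (Fin n) → ℂ}
    (hφ : ContDiff ℝ ∞ φ) : Continuous (Δ φ) := by
  rw [InnerProductSpace.laplacian_eq_iteratedFDeriv_stdOrthonormalBasis]
  have h : Continuous (iteratedFDeriv ℝ 2 φ) :=
    (contDiff_infty.1 hφ 2).continuous_iteratedFDeriv (m := 2) (by simp)
  refine continuous_finsetSum _ fun i _ => ?_
  exact (ContinuousMultilinearMap.apply ℝ (fun _ : Fin 2 => EuclideanSpace ℝ (Fin n)) ℂ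
    ![_, _]).continuous.comp h

theorem hasCompactSupport_laplacian_test {n : ℕ} {φ : EuclideanSpace ℝ (Fin n) → ℂ}
    (hc : HasCompactSupport φ) : HasCompactSupport (Δ φ) := by
  rw [InnerProductSpace.laplacian_eq_iteratedFDeriv_stdOrthonormalBasis]
  refine (hc.iteratedFDeriv (𝕜 := ℝ) 2).mono fun x hx => ?_
  rw [Function.mem_support] at hx ⊢
  intro h0
  exact hx (by simp [h0])

theorem locallyIntegrable_LpC {n : ℕ} {p : ℝ} (hp : 1 ≤ p) (u : LpC n p) :
    LocallyIntegrable (u : EuclideanSpace ℝ (Fin n) → ℂ) :=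
  (Lp.memLp u).locallyIntegrable (by simpa using hp)

theorem IsWeakSchrodinger.congr {n : ℕ} {a b u u' f f' : EuclideanSpace ℝ (Fin n) → ℂ}
    (h : IsWeakSchrodinger a b u f) (hu : u =ᵐ[volume] u') (hf : f =ᵐ[volume] f') :
    IsWeakSchrodinger a b u' f' := by
  have hV : (fun x => a x * (b x * u x)) =ᵐ[volume] fun x => a x * (b x * u' x) := by
    filter_upwards [hu] with x hx
    rw [hx]
  refine ⟨h.1.congr hV, fun φ h1 h2 => ?_⟩
  have j₁ : ∫ x, u x * Δ φ x = ∫ x, u' x * Δ φ x :=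
    integral_congr_ae (hu.mono fun x hx => by simp [hx])
  have j₂ : ∫ x, (a x * (b x * u x)) * φ x = ∫ x, (a x * (b x * u' x)) * φ x :=
    integral_congr_ae (hu.mono fun x hx => by simp [hx])
  have j₃ : ∫ x, f x * φ x = ∫ x, f' x * φ x :=
    integral_congr_ae (hf.mono fun x hx => by simp [hx])
  rw [← j₁, ← j₂, ← j₃]
  exact h.2 φ h1 h2

theorem IsWeakSchrodinger.add {n : ℕ} {a b u v f g : EuclideanSpace ℝ (Fin n) → ℂ}
    (hu : LocallyIntegrable u) (hv : LocallyIntegrable v) (hf : LocallyIntegrable f)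
    (hg : LocallyIntegrable g) (h₁ : IsWeakSchrodinger a b u f)
    (h₂ : IsWeakSchrodinger a b v g) : IsWeakSchrodinger a b (u + v) (f + g) := by
  have hV : (fun x => a x * (b x * (u + v) x))
      = (fun x => a x * (b x * u x)) + fun x => a x * (b x * v x) := by
    funext x
    simp only [Pi.add_apply]
    ring
  refine ⟨hV ▸ h₁.1.add h₂.1, fun φ hφ hc => ?_⟩
  have e₁ := h₁.2 φ hφ hc
  have e₂ := h₂.2 φ hφ hc
  have hL := continuous_laplacian_test hφ
  have hLc := hasCompactSupport_laplacian_test hc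
  have i₁ := integral_add (integrable_mul_test hu hL hLc) (integrable_mul_test hv hL hLc)
  have i₂ := integral_add (integrable_mul_test h₁.1 hφ.continuous hc)
    (integrable_mul_test h₂.1 hφ.continuous hc)
  have i₃ := integral_add (integrable_mul_test hf hφ.continuous hc)
    (integrable_mul_test hg hφ.continuous hc)
  simp only [Pi.add_apply, mul_add, add_mul] at i₁ i₂ i₃ ⊢
  rw [i₁, i₂, i₃, ← e₁, ← e₂]
  ring

theorem IsWeakSchrodinger.smul {n : ℕ} {a b u f : EuclideanSpace ℝ (Fin n) → ℂ} (c : ℂ)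
    (h : IsWeakSchrodinger a b u f) : IsWeakSchrodinger a b (c • u) (c • f) := by
  have hV : (fun x => a x * (b x * (c • u) x)) = c • fun x => a x * (b x * u x) := by
    funext x
    simp only [Pi.smul_apply, smul_eq_mul]
    ring
  refine ⟨hV ▸ h.1.smul c, fun φ hφ hc => ?_⟩
  have e := h.2 φ hφ hc
  have i₁ := integral_const_mul (μ := volume) c (fun x => u x * Δ φ x)
  have i₂ := integral_const_mul (μ := volume) c (fun x => (a x * (b x * u x)) * φ x)
  have i₃ := integral_const_mul (μ := volume) c (fun x => f x * φ x)
  have j₁ : (fun x => (c • u) x * Δ φ x) = fun x => c * (u x * Δ φ x) := by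
    funext x
    simp only [Pi.smul_apply, smul_eq_mul]
    ring
  have j₂ : (fun x => (a x * (b x * (c • u) x)) * φ x)
      = fun x => c * ((a x * (b x * u x)) * φ x) := by
    funext x
    simp only [Pi.smul_apply, smul_eq_mul]
    ring
  have j₃ : (fun x => (c • f) x * φ x) = fun x => c * (f x * φ x) := by
    funext x
    simp only [Pi.smul_apply, smul_eq_mul]
    ring
  rw [j₁, j₂, j₃, i₁, i₂, i₃, ← e]
  ring

/-- The graph of the Schrödinger operator `H = -Δ + a b` in `L_p(ℝⁿ)`: the pairs `(u, f)` in
`L_p × L_p` such that `u` lies in the maximal domain of the multiplication operator `B` (that is,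
`b u ∈ L_p`) and `-Δ u + a (b u) = f` as distributions. -/
def schrodingerGraph {n : ℕ} (p : ℝ) (hp : 1 < p) (a b : EuclideanSpace ℝ (Fin n) → ℂ) :
    Submodule ℂ (LpC n p × LpC n p) where
  carrier := {x | MemLp (fun y => b y * x.1 y) (ENNReal.ofReal p) volume ∧
    IsWeakSchrodinger a b x.1 x.2}
  zero_mem' := by
    have h0 : ((0 : LpC n p) : EuclideanSpace ℝ (Fin n) → ℂ) =ᵐ[volume] fun _ => 0 :=
      Lp.coeFn_zero _ _ _
    have hw : IsWeakSchrodinger a b (fun _ => 0) (fun _ => 0) := by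
      refine ⟨?_, fun φ _ _ => by simp⟩
      simpa using (locallyIntegrable_zero :
        LocallyIntegrable (fun _ : EuclideanSpace ℝ (Fin n) => (0 : ℂ)) volume)
    refine ⟨?_, hw.congr h0.symm h0.symm⟩
    refine (MemLp.zero' (ε := ℂ)).ae_eq ?_
    filter_upwards [h0] with x hx
    simp only [Prod.fst_zero]
    rw [hx, mul_zero]
  add_mem' := by
    rintro ⟨u, f⟩ ⟨v, g⟩ ⟨hu, hu'⟩ ⟨hv, hv'⟩
    refine ⟨(hu.add hv).ae_eq ?_, ?_⟩
    · filter_upwards [Lp.coeFn_add u v] with x hx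
      simp only [Prod.mk_add_mk, Pi.add_apply]
      rw [hx, Pi.add_apply, mul_add]
    · exact (IsWeakSchrodinger.add (locallyIntegrable_LpC hp.le u) (locallyIntegrable_LpC hp.le v)
        (locallyIntegrable_LpC hp.le f) (locallyIntegrable_LpC hp.le g) hu' hv').congr
        (Lp.coeFn_add u v).symm (Lp.coeFn_add f g).symm
  smul_mem' := by
    rintro c ⟨u, f⟩ ⟨hu, hu'⟩
    refine ⟨(hu.const_smul c).ae_eq ?_, ?_⟩
    · filter_upwards [Lp.coeFn_smul c u] with x hx
      simp only [Prod.smul_mk, Pi.smul_apply, smul_eq_mul]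
      rw [hx, Pi.smul_apply, smul_eq_mul]
      ring
    · exact (hu'.smul c).congr (Lp.coeFn_smul c u).symm (Lp.coeFn_smul c f).symm

/-- `schrodingerGraph` is single-valued, so it is the graph of a linear operator. -/
theorem schrodingerGraph_snd_eq_zero {n : ℕ} (p : ℝ) (hp : 1 < p)
    (a b : EuclideanSpace ℝ (Fin n) → ℂ) (x : LpC n p × LpC n p)
    (hx : x ∈ schrodingerGraph p hp a b) (hx0 : x.1 = 0) : x.2 = 0 := by
  obtain ⟨u, f⟩ := x
  obtain ⟨-, h⟩ := hx
  dsimp only at hx0 h ⊢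
  subst hx0
  have h0 : ((0 : LpC n p) : EuclideanSpace ℝ (Fin n) → ℂ) =ᵐ[volume] fun _ => 0 :=
    Lp.coeFn_zero _ _ _
  have h' := h.congr h0 (Filter.EventuallyEq.refl _ _)
  apply (Lp.eq_zero_iff_ae_eq_zero).2
  refine ae_eq_zero_of_integral_contDiff_smul_eq_zero (locallyIntegrable_LpC hp.le f)
    fun g hg hgc => ?_
  have e := h'.2 (fun x => (g x : ℂ)) (Complex.ofRealCLM.contDiff.comp hg)
    (hgc.comp_left (g := fun t : ℝ => (t : ℂ)) (by simp))
  simp only [zero_mul, mul_zero, integral_zero, neg_zero, add_zero] at e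
  rw [e]
  refine integral_congr_ae (Filter.Eventually.of_forall fun x => ?_)
  simp [mul_comm]

/-- The Schrödinger operator `H = -Δ + q`, `q = a b`, in `L_p(ℝⁿ)`: the linear operator with graph
`schrodingerGraph`. For `a`, `b` in the Stummel classes it is the closed extension of `H₀ + A B`
whose resolvent is `R(z) - R(z)A (1 + B R(z) A)⁻¹ B R(z)` with `R(z) = (H₀ - z)⁻¹`. -/
def schrodingerOp {n : ℕ} (p : ℝ) (hp : 1 < p) (a b : EuclideanSpace ℝ (Fin n) → ℂ) :
    LpC n p →ₗ.[ℂ] LpC n p :=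
  (schrodingerGraph p hp a b).toLinearPMap

theorem schrodingerOp_graph {n : ℕ} (p : ℝ) (hp : 1 < p) (a b : EuclideanSpace ℝ (Fin n) → ℂ) :
    (schrodingerOp p hp a b).graph = schrodingerGraph p hp a b :=
  Submodule.toLinearPMap_graph_eq _ (schrodingerGraph_snd_eq_zero p hp a b)

/-- `z` is an eigenvalue of the (unbounded) linear operator `T`. -/
def IsEigenvalue {X : Type*} [AddCommGroup X] [Module ℂ X] (T : X →ₗ.[ℂ] X) (z : ℂ) : Prop :=
  ∃ u : T.domain, (u : X) ≠ 0 ∧ T u = z • (u : X)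

/-- The constant `C(n,γ,θ)`. -/
def corConst (n : ℕ) (γ θ : ℝ) : ℝ :=
  1 / ((4 * Real.pi) ^ ((n : ℝ) / 2) * Real.cos θ ^ (2 * γ)) *
    ((2 * γ + n - 2) / (2 * γ + n)) ^ ((n : ℝ) * (2 * γ + n - 2) / 4) *
    Real.Gamma (2 * γ / (2 * γ + n)) ^ (γ + (n : ℝ) / 2)

end

/-! Let `Hu = zu` with `κ = -Re z > 0`, so that `u = -(-Δ - z)⁻¹(qu)`. Writing the resolvent as the
Laplace transform of the heat semigroup and using `|exp (zt)| = exp (-κt)` gives the pointwise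
domination `|u| ≤ (-Δ + κ)⁻¹|qu|` (`enorm_resolvent_le`, `IsWeakSchrodinger.enorm_le_resK_conv`).
Multiplication by `|q|` makes this an inequality for the single nonnegative function `|qu|`.
Integration over `ℝⁿ` would then give `‖qu‖₁ ≤ K ‖qu‖₁` with `K = sup_y ∫ |q(x)| G_κ(x - y) dx`,
where `G_κ` is the kernel of `(-Δ + κ)⁻¹`, hence `1 ≤ K` as soon as `0 < ‖qu‖₁ < ∞`.

Finiteness of `‖qu‖₁` is not available; the Stummel condition on `a` and `bu ∈ L_p` only make `qu`
integrable against `(1 + |x|)^{-m}` for `m > n`. The argument therefore runs in `L¹(w)` with `w(x) =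
(1 + δ|x|)^{-m}`. Since `w(x) ≤ exp (η|x - y|) w(y)` for small `δ`, the weight costs only the
replacement of `G_κ` by a Gaussian Laplace transform with parameters `κ - η`, `1 - η`
(`exp_mul_resK_le`, `lintegral_mul_weight_resK_le`).

The constant comes from Hölder's inequality with exponent `r = γ + n/2`, applied at each fixed time
before integrating in time (`lintegral_mul_resK_le`): the Gaussian norm gives the power of `(r -
1)/r`, the time integral gives `Γ(γ/r)` and `κ^{-γ/r}`. Letting `η → 0` and raising to the power `r`
bounds `κ^γ`, and `κ = |z| cos θ`. -/

open Real in
/-- The Gaussian `(4πt)^{-n/2} exp (-σ|x|²/(4t))` on `ℝⁿ`; for `σ = 1` this is the heat kernel. -/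
noncomputable def gaussK {n : ℕ} (σ t : ℝ) (x : EuclideanSpace ℝ (Fin n)) : ℝ :=
  (4 * π * t) ^ (-(n : ℝ) / 2) * exp (-(σ * ‖x‖ ^ 2 / (4 * t)))

/-- The Laplace transform in time of the Gaussian `gaussK σ`; for `σ = 1` this is the convolution
kernel of `(-Δ + κ)⁻¹`. -/
noncomputable def resK {n : ℕ} (κ σ : ℝ) (x : EuclideanSpace ℝ (Fin n)) : ℝ≥0∞ :=
  ∫⁻ t in Set.Ioi (0 : ℝ), ENNReal.ofReal (Real.exp (-(κ * t)) * gaussK σ t x)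

/-! ### Gaussian kernels, their Laplace transforms and Hölder bounds -/

section Kernel

variable {n : ℕ}

theorem gaussK_nonneg {σ t : ℝ} (ht : 0 < t) (x : EuclideanSpace ℝ (Fin n)) :
    0 ≤ gaussK σ t x := by
  unfold gaussK
  positivity

theorem measurable_gaussK (σ : ℝ) :
    Measurable fun p : ℝ × EuclideanSpace ℝ (Fin n) => gaussK σ p.1 p.2 := by
  unfold gaussK
  fun_prop

theorem measurable_resK (κ σ : ℝ) :
    Measurable (resK κ σ : EuclideanSpace ℝ (Fin n) → ℝ≥0∞) := by
  unfold resK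
  refine Measurable.lintegral_prod_left'
    (f := fun p : ℝ × EuclideanSpace ℝ (Fin n) =>
      ENNReal.ofReal (Real.exp (-(κ * p.1)) * gaussK σ p.1 p.2)) ?_
  have := measurable_gaussK (n := n) σ
  fun_prop

/-- By the inequality of arithmetic and geometric means `‖x‖ ≤ t + ‖x‖²/(4t)`, so at each time the
exponential growth is absorbed by lowering both the decay rate in time and the Gaussian rate in
space by `η`. -/
theorem exp_mul_resK_le {κ η : ℝ} (hη : 0 < η) (x : EuclideanSpace ℝ (Fin n)) :
    ENNReal.ofReal (Real.exp (η * ‖x‖)) * resK κ 1 x ≤ resK (κ - η) (1 - η) x := by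
  unfold resK
  rw [← lintegral_const_mul' _ _ ENNReal.ofReal_ne_top]
  refine setLIntegral_mono' measurableSet_Ioi fun t ht => ?_
  have ht : 0 < t := ht
  rw [← ENNReal.ofReal_mul (Real.exp_pos _).le]
  refine ENNReal.ofReal_le_ofReal ?_
  unfold gaussK
  have key : η * ‖x‖ - κ * t - 1 * ‖x‖ ^ 2 / (4 * t)
      ≤ -((κ - η) * t) - (1 - η) * ‖x‖ ^ 2 / (4 * t) := by
    have h1 : 0 ≤ η * (‖x‖ / (2 * t) - 1) ^ 2 * t := by positivity
    have h2 : η * (‖x‖ / (2 * t) - 1) ^ 2 * t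
        = η * ‖x‖ ^ 2 / (4 * t) - η * ‖x‖ + η * t := by
      field_simp
      ring
    have h3 : (1 - η) * ‖x‖ ^ 2 / (4 * t) = 1 * ‖x‖ ^ 2 / (4 * t) - η * ‖x‖ ^ 2 / (4 * t) := by
      ring
    rw [h3]
    linarith
  have hp : 0 ≤ (4 * Real.pi * t) ^ (-(n : ℝ) / 2) := by positivity
  calc Real.exp (η * ‖x‖) * (Real.exp (-(κ * t)) *
        ((4 * Real.pi * t) ^ (-(n : ℝ) / 2) * Real.exp (-(1 * ‖x‖ ^ 2 / (4 * t)))))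
      = (4 * Real.pi * t) ^ (-(n : ℝ) / 2)
        * Real.exp (η * ‖x‖ - κ * t - 1 * ‖x‖ ^ 2 / (4 * t)) := by
        rw [sub_eq_add_neg, sub_eq_add_neg, Real.exp_add, Real.exp_add]
        ring
    _ ≤ (4 * Real.pi * t) ^ (-(n : ℝ) / 2)
        * Real.exp (-((κ - η) * t) - (1 - η) * ‖x‖ ^ 2 / (4 * t)) := by gcongr
    _ = _ := by
        rw [sub_eq_add_neg (-((κ - η) * t)), Real.exp_add]
        ring

theorem lintegral_exp_neg_mul_sq_norm {b : ℝ} (hb : 0 < b) (y : EuclideanSpace ℝ (Fin n)) :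
    ∫⁻ x : EuclideanSpace ℝ (Fin n), ENNReal.ofReal (Real.exp (-b * ‖x - y‖ ^ 2))
      = ENNReal.ofReal ((Real.pi / b) ^ ((n : ℝ) / 2)) := by
  rw [lintegral_sub_right_eq_self
    (fun x : EuclideanSpace ℝ (Fin n) => ENNReal.ofReal (Real.exp (-b * ‖x‖ ^ 2))) y]
  have hI := GaussianFourier.integral_rexp_neg_mul_sq_norm (V := EuclideanSpace ℝ (Fin n)) hb
  rw [finrank_euclideanSpace_fin] at hI
  rw [← hI, ofReal_integral_eq_lintegral_ofReal]
  -- A non-integrable function has Bochner integral `0`, which contradicts the positive value in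
  -- `hI`.
  · by_contra hni
    rw [integral_undef hni] at hI
    have : 0 < (Real.pi / b) ^ ((n : ℝ) / 2) := by positivity
    exact this.ne hI
  · exact Filter.Eventually.of_forall fun x => (Real.exp_pos _).le

/-- Hölder's inequality with the explicit norm of the Gaussian in the conjugate exponent `r/(r -
1)`. -/
theorem lintegral_mul_gaussK_le {r σ t : ℝ} (hr : 1 ≤ r) (hσ : 0 < σ) (ht : 0 < t)
    {g : EuclideanSpace ℝ (Fin n) → ℝ≥0∞} (hg : AEMeasurable g)
    (y : EuclideanSpace ℝ (Fin n)) :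
    ∫⁻ x, g x * ENNReal.ofReal (gaussK σ t (x - y))
      ≤ (∫⁻ x, g x ^ r) ^ (1 / r) *
        ENNReal.ofReal ((4 * Real.pi * t) ^ (-(n : ℝ) / (2 * r)) *
          ((r - 1) / (r * σ)) ^ (n * (r - 1) / (2 * r))) := by
  have hA : 0 < 4 * Real.pi * t := by positivity
  -- For `r = 1` the conjugate exponent is infinite and the Gaussian is bounded by its maximum; the
  -- factor `0 ^ 0 = 1` makes the formula cover this case.
  rcases hr.eq_or_lt with rfl | hr1
  · simp only [sub_self, zero_div, mul_zero, Real.rpow_zero, mul_one, div_one, ENNReal.rpow_one]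
    rw [← lintegral_mul_const' _ _ ENNReal.ofReal_ne_top]
    refine lintegral_mono fun x => ?_
    dsimp only
    gcongr
    unfold gaussK
    refine mul_le_of_le_one_right (by positivity) (Real.exp_le_one_iff.2 ?_)
    have : 0 ≤ σ * ‖x - y‖ ^ 2 / (4 * t) := by positivity
    linarith
  · have hc : r.HolderConjugate (r / (r - 1)) := Real.HolderConjugate.conjExponent hr1
    have hr0 : 0 < r := by linarith
    have hr10 : 0 < r - 1 := by linarith
    have hgm : Measurable fun x : EuclideanSpace ℝ (Fin n) =>
        ENNReal.ofReal (gaussK σ t (x - y)) := by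
      have := measurable_gaussK (n := n) σ
      have h2 : Measurable fun x : EuclideanSpace ℝ (Fin n) => gaussK σ t (x - y) :=
        this.comp (f := fun x : EuclideanSpace ℝ (Fin n) => (t, x - y)) (by fun_prop)
      exact h2.ennreal_ofReal
    refine (ENNReal.lintegral_mul_le_Lp_mul_Lq volume hc hg hgm.aemeasurable).trans ?_
    gcongr
    set s := r / (r - 1) with hs
    have hs0 : 0 < s := by positivity
    have hb : 0 < s * σ / (4 * t) := by positivity
    have e1 : ∀ x : EuclideanSpace ℝ (Fin n), ENNReal.ofReal (gaussK σ t (x - y)) ^ s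
        = ENNReal.ofReal ((4 * Real.pi * t) ^ (-(n : ℝ) / 2 * s)) *
          ENNReal.ofReal (Real.exp (-(s * σ / (4 * t)) * ‖x - y‖ ^ 2)) := by
      intro x
      rw [ENNReal.ofReal_rpow_of_nonneg (gaussK_nonneg ht _) hs0.le,
        ← ENNReal.ofReal_mul (by positivity)]
      congr 1
      unfold gaussK
      rw [Real.mul_rpow (by positivity) (Real.exp_pos _).le, ← Real.rpow_mul hA.le,
        ← Real.exp_mul]
      congr 2
      ring
    simp_rw [e1]
    rw [lintegral_const_mul' _ _ ENNReal.ofReal_ne_top, lintegral_exp_neg_mul_sq_norm hb,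
      ← ENNReal.ofReal_mul (by positivity), ENNReal.ofReal_rpow_of_nonneg (by positivity)
        (by positivity)]
    refine ENNReal.ofReal_le_ofReal (le_of_eq ?_)
    have e2 : Real.pi / (s * σ / (4 * t)) = (4 * Real.pi * t) * ((r - 1) / (r * σ)) := by
      rw [hs]
      field_simp
    rw [e2, Real.mul_rpow hA.le (by positivity), ← mul_assoc, ← Real.rpow_add hA,
      Real.mul_rpow (by positivity) (by positivity), ← Real.rpow_mul hA.le,
      ← Real.rpow_mul (by positivity)]
    congr 2
    · rw [hs]
      field_simp
      ring
    · rw [hs]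
      field_simp

theorem lintegral_rpow_mul_exp_neg_mul {s κ : ℝ} (hs : 0 < s) (hκ : 0 < κ) :
    ∫⁻ t in Set.Ioi (0 : ℝ), ENNReal.ofReal (t ^ (s - 1) * Real.exp (-(κ * t)))
      = ENNReal.ofReal (Real.Gamma s * κ ^ (-s)) := by
  have hI := Real.integral_rpow_mul_exp_neg_mul_Ioi hs hκ
  have hv : (1 / κ) ^ s * Real.Gamma s = Real.Gamma s * κ ^ (-s) := by
    rw [one_div, Real.inv_rpow hκ.le, Real.rpow_neg hκ.le, mul_comm]
  rw [hv] at hI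
  rw [← hI, ofReal_integral_eq_lintegral_ofReal]
  · by_contra hni
    rw [integral_undef hni] at hI
    have : 0 < Real.Gamma s * κ ^ (-s) := mul_pos (Real.Gamma_pos_of_pos hs) (by positivity)
    exact this.ne hI
  · filter_upwards [ae_restrict_mem measurableSet_Ioi] with t ht
    have ht : 0 < t := ht
    positivity

theorem measurable_ofReal_exp_mul_gaussK (κ σ : ℝ) (y : EuclideanSpace ℝ (Fin n)) :
    Measurable fun p : EuclideanSpace ℝ (Fin n) × ℝ =>
      ENNReal.ofReal (Real.exp (-(κ * p.2)) * gaussK σ p.2 (p.1 - y)) := by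
  have h := (measurable_gaussK (n := n) σ).comp
    (f := fun p : EuclideanSpace ℝ (Fin n) × ℝ => (p.2, p.1 - y)) (by fun_prop)
  have h2 : Measurable fun p : EuclideanSpace ℝ (Fin n) × ℝ => gaussK σ p.2 (p.1 - y) := h
  fun_prop

theorem lintegral_mul_resK {κ σ : ℝ} {g : EuclideanSpace ℝ (Fin n) → ℝ≥0∞}
    (hg : AEMeasurable g) (y : EuclideanSpace ℝ (Fin n)) :
    ∫⁻ x, g x * resK κ σ (x - y)
      = ∫⁻ t in Set.Ioi (0 : ℝ), ENNReal.ofReal (Real.exp (-(κ * t))) *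
          ∫⁻ x, g x * ENNReal.ofReal (gaussK σ t (x - y)) := by
  have hm := measurable_ofReal_exp_mul_gaussK (n := n) κ σ y
  have e1 : ∀ x, g x * resK κ σ (x - y) = ∫⁻ t in Set.Ioi (0 : ℝ),
      g x * ENNReal.ofReal (Real.exp (-(κ * t)) * gaussK σ t (x - y)) := by
    intro x
    have hx : Measurable fun t => ENNReal.ofReal (Real.exp (-(κ * t)) * gaussK σ t (x - y)) :=
      hm.comp measurable_prodMk_left
    rw [lintegral_const_mul _ hx]
    rfl
  simp_rw [e1]
  rw [lintegral_lintegral_swap]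
  · refine lintegral_congr fun t => ?_
    rw [← lintegral_const_mul' _ _ ENNReal.ofReal_ne_top]
    refine lintegral_congr fun x => ?_
    rw [ENNReal.ofReal_mul (Real.exp_pos _).le]
    ring
  · exact hg.comp_fst.mul hm.aemeasurable

/-- Hölder at time `t` leaves the factor `t^{-n/(2r)}`, integrable at `0` precisely because `n/(2r)
< 1`; its Laplace transform is the Gamma factor. -/
theorem lintegral_mul_resK_le {r κ σ : ℝ} (hr : 1 ≤ r) (hnr : (n : ℝ) / (2 * r) < 1)
    (hκ : 0 < κ) (hσ : 0 < σ)
    {g : EuclideanSpace ℝ (Fin n) → ℝ≥0∞} (hg : AEMeasurable g)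
    (y : EuclideanSpace ℝ (Fin n)) :
    ∫⁻ x, g x * resK κ σ (x - y)
      ≤ (∫⁻ x, g x ^ r) ^ (1 / r) *
        ENNReal.ofReal ((4 * Real.pi) ^ (-(n : ℝ) / (2 * r)) *
          ((r - 1) / (r * σ)) ^ (n * (r - 1) / (2 * r)) *
          (Real.Gamma (1 - n / (2 * r)) * κ ^ (-(1 - n / (2 * r))))) := by
  have hr0 : 0 < r := by linarith
  have hr1 : 0 ≤ r - 1 := by linarith
  rw [lintegral_mul_resK hg]
  set C := (4 * Real.pi) ^ (-(n : ℝ) / (2 * r)) * ((r - 1) / (r * σ)) ^ (n * (r - 1) / (2 * r))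
    with hC
  have hC0 : 0 ≤ C := by positivity
  set Q := (∫⁻ x, g x ^ r) ^ (1 / r)
  calc ∫⁻ t in Set.Ioi (0 : ℝ), ENNReal.ofReal (Real.exp (-(κ * t))) *
          ∫⁻ x, g x * ENNReal.ofReal (gaussK σ t (x - y))
      ≤ ∫⁻ t in Set.Ioi (0 : ℝ), (Q * ENNReal.ofReal C) *
          ENNReal.ofReal (t ^ ((1 - n / (2 * r)) - 1) * Real.exp (-(κ * t))) := by
        refine setLIntegral_mono' measurableSet_Ioi fun t ht => ?_
        have ht : 0 < t := ht
        grw [lintegral_mul_gaussK_le hr hσ ht hg y]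
        apply le_of_eq
        have e : (4 * Real.pi * t) ^ (-(n : ℝ) / (2 * r)) *
            ((r - 1) / (r * σ)) ^ (n * (r - 1) / (2 * r))
            = C * t ^ ((1 - n / (2 * r)) - 1) := by
          rw [Real.mul_rpow (by positivity) ht.le, hC]
          have : (1 - n / (2 * r)) - 1 = -(n : ℝ) / (2 * r) := by ring
          rw [this]
          ring
        rw [e, ENNReal.ofReal_mul hC0, ENNReal.ofReal_mul (p := t ^ _) (by positivity)]
        change _ * (Q * _) = _
        generalize ENNReal.ofReal C = C'
        ring
    _ = Q * ENNReal.ofReal C * ENNReal.ofReal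
          (Real.Gamma (1 - n / (2 * r)) * κ ^ (-(1 - n / (2 * r)))) := by
        rw [lintegral_const_mul _ (by fun_prop), lintegral_rpow_mul_exp_neg_mul (by linarith) hκ]
    _ = _ := by rw [ENNReal.ofReal_mul hC0, mul_assoc]

/-- A Gaussian with parameter `σ` has mass `σ^{-n/2}` at every time. The formula is used to see that
convolution with the resolvent kernel preserves weighted integrability. -/
theorem lintegral_resK {κ σ : ℝ} (hκ : 0 < κ) (hσ : 0 < σ) (y : EuclideanSpace ℝ (Fin n)) :
    ∫⁻ x, resK κ σ (x - y) = ENNReal.ofReal (σ ^ (-(n : ℝ) / 2) * κ⁻¹) := by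
  have h := lintegral_mul_resK (n := n) (κ := κ) (σ := σ) (g := fun _ => 1) aemeasurable_const y
  simp only [one_mul] at h
  rw [h]
  have e : ∀ t ∈ Set.Ioi (0 : ℝ), ENNReal.ofReal (Real.exp (-(κ * t))) *
        ∫⁻ x : EuclideanSpace ℝ (Fin n), ENNReal.ofReal (gaussK σ t (x - y))
      = ENNReal.ofReal (σ ^ (-(n : ℝ) / 2)) *
        ENNReal.ofReal (t ^ ((1 : ℝ) - 1) * Real.exp (-(κ * t))) := by
    intro t ht
    have ht : 0 < t := ht
    have e1 : ∀ x : EuclideanSpace ℝ (Fin n), ENNReal.ofReal (gaussK σ t (x - y))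
        = ENNReal.ofReal ((4 * Real.pi * t) ^ (-(n : ℝ) / 2)) *
          ENNReal.ofReal (Real.exp (-(σ / (4 * t)) * ‖x - y‖ ^ 2)) := by
      intro x
      rw [← ENNReal.ofReal_mul (by positivity)]
      unfold gaussK
      congr 3
      ring
    have hb : 0 < σ / (4 * t) := by positivity
    simp_rw [e1]
    rw [lintegral_const_mul' _ _ ENNReal.ofReal_ne_top, lintegral_exp_neg_mul_sq_norm hb,
      ← ENNReal.ofReal_mul (by positivity), mul_comm, sub_self, Real.rpow_zero, one_mul]
    congr 2
    have e2 : Real.pi / (σ / (4 * t)) = (4 * Real.pi * t) * σ⁻¹ := by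
      field_simp
    have hA : 0 < 4 * Real.pi * t := by positivity
    rw [e2, Real.mul_rpow hA.le (inv_pos.2 hσ).le, ← mul_assoc, ← Real.rpow_add hA, Real.inv_rpow hσ.le, ← Real.rpow_neg hσ.le]
    simp [neg_div]
  rw [setLIntegral_congr_fun measurableSet_Ioi e, lintegral_const_mul _ (by fun_prop),
    lintegral_rpow_mul_exp_neg_mul one_pos hκ, ← ENNReal.ofReal_mul (by positivity)]
  simp [Real.rpow_neg_one]

/-- If `w` varies by at most the factor `exp (η|x - y|)`, convolution with `resK κ 1` followed by
multiplication with `g` acts on `L¹(w)` with norm at most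
`sup_y ∫ g x * resK (κ - η) (1 - η) (x - y)`. -/
theorem lintegral_mul_weight_resK_le {κ η : ℝ} (hη : 0 < η)
    {g f w : EuclideanSpace ℝ (Fin n) → ℝ≥0∞} (hg : AEMeasurable g) (hf : AEMeasurable f)
    (hw : Measurable w) (hwη : ∀ x y, w x ≤ ENNReal.ofReal (Real.exp (η * ‖x - y‖)) * w y)
    {K : ℝ≥0∞} (hK : ∀ y, ∫⁻ x, g x * resK (κ - η) (1 - η) (x - y) ≤ K) :
    ∫⁻ x, g x * w x * ∫⁻ y, resK κ 1 (x - y) * f y ≤ K * ∫⁻ y, f y * w y := by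
  have hG := measurable_resK (n := n) κ 1
  have hG2 : Measurable fun p : EuclideanSpace ℝ (Fin n) × EuclideanSpace ℝ (Fin n) =>
      resK κ 1 (p.1 - p.2) := hG.comp (measurable_fst.sub measurable_snd)
  calc ∫⁻ x, g x * w x * ∫⁻ y, resK κ 1 (x - y) * f y
      = ∫⁻ x, ∫⁻ y, g x * w x * (resK κ 1 (x - y) * f y) := by
        refine lintegral_congr fun x => ?_
        rw [lintegral_const_mul'']
        exact (hG2.comp measurable_prodMk_left).aemeasurable.mul hf
    _ = ∫⁻ y, ∫⁻ x, g x * w x * (resK κ 1 (x - y) * f y) := by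
        refine lintegral_lintegral_swap ?_
        exact ((hg.mul hw.aemeasurable).comp_fst).mul (hG2.aemeasurable.mul hf.comp_snd)
    _ ≤ ∫⁻ y, ∫⁻ x, (f y * w y) * (g x * resK (κ - η) (1 - η) (x - y)) := by
        refine lintegral_mono fun y => lintegral_mono fun x => ?_
        dsimp only
        calc g x * w x * (resK κ 1 (x - y) * f y)
            ≤ g x * (ENNReal.ofReal (Real.exp (η * ‖x - y‖)) * w y) * (resK κ 1 (x - y) * f y) := by
              gcongr
              exact hwη x y
          _ = (f y * w y) * (g x * (ENNReal.ofReal (Real.exp (η * ‖x - y‖)) *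
                resK κ 1 (x - y))) := by ring
          _ ≤ _ := by
              gcongr
              exact exp_mul_resK_le hη _
    _ = ∫⁻ y, (f y * w y) * ∫⁻ x, g x * resK (κ - η) (1 - η) (x - y) := by
        refine lintegral_congr fun y => ?_
        rw [lintegral_const_mul'']
        have := (measurable_resK (n := n) (κ - η) (1 - η)).comp (measurable_id.sub_const y)
        exact hg.mul this.aemeasurable
    _ ≤ ∫⁻ y, K * (f y * w y) := by
        refine lintegral_mono fun y => ?_
        dsimp only
        rw [mul_comm]
        gcongr
        exact hK y
    _ = _ := lintegral_const_mul'' _ (hf.mul hw.aemeasurable)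

/-! ### Slowly varying polynomial weights -/

/-- The polynomial weight `(1 + δ|x|)^{-m}`. -/
noncomputable def polyWeight (n : ℕ) (m : ℕ) (δ : ℝ) (x : EuclideanSpace ℝ (Fin n)) : ℝ :=
  ((1 + δ * ‖x‖) ^ m)⁻¹

theorem polyWeight_pos {m : ℕ} {δ : ℝ} (hδ : 0 ≤ δ) (x : EuclideanSpace ℝ (Fin n)) :
    0 < polyWeight n m δ x := by
  unfold polyWeight
  positivity

theorem continuous_polyWeight (m : ℕ) {δ : ℝ} (hδ : 0 ≤ δ) : Continuous (polyWeight n m δ) := by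
  unfold polyWeight
  refine Continuous.inv₀ (by fun_prop) fun x => ?_
  positivity

/-- The triangle inequality and `1 + s ≤ exp s` show that `1 + δ‖x‖` varies by at most `exp (δ‖x -
y‖)`; the power `m` multiplies the rate. -/
theorem polyWeight_le_exp_mul {m : ℕ} {δ : ℝ} (hδ : 0 ≤ δ) (x y : EuclideanSpace ℝ (Fin n)) :
    polyWeight n m δ x ≤ Real.exp (m * δ * ‖x - y‖) * polyWeight n m δ y := by
  unfold polyWeight
  have h1 : 1 + δ * ‖y‖ ≤ (1 + δ * ‖x‖) * Real.exp (δ * ‖x - y‖) := by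
    have h2 : ‖y‖ ≤ ‖x‖ + ‖x - y‖ := by
      have := norm_sub_le x (x - y)
      simpa using this
    have h3 : 1 + δ * ‖x - y‖ ≤ Real.exp (δ * ‖x - y‖) := by
      linarith [Real.add_one_le_exp (δ * ‖x - y‖)]
    have h4 : 0 ≤ δ * ‖x‖ * (δ * ‖x - y‖) := by positivity
    have h6 : δ * ‖y‖ ≤ δ * (‖x‖ + ‖x - y‖) := by gcongr
    calc 1 + δ * ‖y‖ ≤ (1 + δ * ‖x‖) * (1 + δ * ‖x - y‖) := by linarith
      _ ≤ _ := by gcongr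
  have h5 : (1 + δ * ‖y‖) ^ m ≤ (1 + δ * ‖x‖) ^ m * Real.exp (m * δ * ‖x - y‖) := by
    calc (1 + δ * ‖y‖) ^ m ≤ ((1 + δ * ‖x‖) * Real.exp (δ * ‖x - y‖)) ^ m := by gcongr
      _ = _ := by
        rw [mul_pow, ← Real.exp_nat_mul]
        ring_nf
  rw [← div_eq_mul_inv, inv_eq_one_div, div_le_div_iff₀ (by positivity) (by positivity)]
  linarith

theorem polyWeight_le_mul {m : ℕ} {δ : ℝ} (hδ : 0 < δ) (hδ1 : δ ≤ 1)
    (x : EuclideanSpace ℝ (Fin n)) :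
    polyWeight n m δ x ≤ (δ ^ m)⁻¹ * polyWeight n m 1 x := by
  unfold polyWeight
  rw [← mul_inv, ← mul_pow]
  gcongr
  nlinarith [norm_nonneg x]

end Kernel

/-! ### The resolvent of the Laplacian on Schwartz functions -/

section Fourier

open Real FourierTransform SchwartzMap

variable {n : ℕ}

theorem add_norm_sq_sub_ne_zero {z : ℂ} (hz : z.re < 0) {c : ℝ} (hc : 0 ≤ c) :
    (c : ℂ) - z ≠ 0 := by
  intro h
  have := congrArg Complex.re h
  simp at this
  linarith

/-- The symbol of `(-Δ - z)⁻¹`. -/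
noncomputable def resolventSymbol (n : ℕ) (z : ℂ) (ξ : EuclideanSpace ℝ (Fin n)) : ℂ :=
  (((2 * π) ^ 2 * ‖ξ‖ ^ 2 : ℝ) - z)⁻¹

/-- With `s = (2π)²‖ξ‖²`, the identity `|s - z|² = s² - 2 (Re z) s + |z|²` has nonnegative terms and
equals `|z|² (1 + ‖Y ξ‖²)` for the vector-valued polynomial map `Y` below. Hence `(s - z)⁻¹` is the
polynomial `(s - z̄)/|z|²` times the function `(1 + ‖·‖²)⁻¹`, known to have temperate growth,
composed with `Y`. -/
theorem hasTemperateGrowth_resolventSymbol {z : ℂ} (hz : z.re < 0) :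
    (resolventSymbol n z).HasTemperateGrowth := by
  have hz0 : 0 < ‖z‖ := norm_pos_iff.2 fun h => by simp [h] at hz
  set c₁ : ℝ := (2 * π) ^ 2 / ‖z‖
  set c₂ : ℝ := √(2 * (-z.re)) * (2 * π) / ‖z‖
  let Y : EuclideanSpace ℝ (Fin n) → WithLp 2 (ℝ × EuclideanSpace ℝ (Fin n)) := fun ξ =>
    WithLp.toLp 2 (c₁ * ‖ξ‖ ^ 2, c₂ • ξ)
  have hY : Y.HasTemperateGrowth := by
    let i₁ : ℝ →L[ℝ] WithLp 2 (ℝ × EuclideanSpace ℝ (Fin n)) :=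
      (WithLp.prodContinuousLinearEquiv 2 ℝ ℝ (EuclideanSpace ℝ (Fin n))).symm.toContinuousLinearMap
        ∘L (ContinuousLinearMap.inl ℝ _ _)
    let i₂ : EuclideanSpace ℝ (Fin n) →L[ℝ] WithLp 2 (ℝ × EuclideanSpace ℝ (Fin n)) :=
      (WithLp.prodContinuousLinearEquiv 2 ℝ ℝ (EuclideanSpace ℝ (Fin n))).symm.toContinuousLinearMap
        ∘L (ContinuousLinearMap.inr ℝ _ _)
    have e : Y = fun ξ => i₁ (c₁ * ‖ξ‖ ^ 2) + i₂ (c₂ • ξ) := by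
      funext ξ
      simp only [Y, i₁, i₂, ContinuousLinearMap.comp_apply, ContinuousLinearMap.inl_apply,
        ContinuousLinearMap.inr_apply]
      change _ = WithLp.toLp 2 (c₁ * ‖ξ‖ ^ 2, 0) + WithLp.toLp 2 (0, c₂ • ξ)
      rw [← WithLp.toLp_add]
      simp
    rw [e]
    have h1 : (fun ξ : EuclideanSpace ℝ (Fin n) => c₁ * ‖ξ‖ ^ 2).HasTemperateGrowth := by fun_prop
    have h2 : (fun ξ : EuclideanSpace ℝ (Fin n) => c₂ • ξ).HasTemperateGrowth := by fun_prop
    exact (i₁.hasTemperateGrowth.comp h1).add (i₂.hasTemperateGrowth.comp h2)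
  have hB := (Function.hasTemperateGrowth_one_add_norm_sq_rpow
    (WithLp 2 (ℝ × EuclideanSpace ℝ (Fin n))) (-1)).comp hY
  have hB' : (fun ξ => (((1 + ‖Y ξ‖ ^ 2) ^ (-1 : ℝ) : ℝ) : ℂ)).HasTemperateGrowth :=
    Function.Complex.hasTemperateGrowth_ofReal.comp hB
  have hA : (fun ξ : EuclideanSpace ℝ (Fin n) =>
      ((((2 * π) ^ 2 * ‖ξ‖ ^ 2 : ℝ) : ℂ) - (starRingEnd ℂ z)) * ((‖z‖ ^ 2)⁻¹ : ℝ)).HasTemperateGrowth := by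
    have h1 : (fun ξ : EuclideanSpace ℝ (Fin n) => (2 * π) ^ 2 * ‖ξ‖ ^ 2).HasTemperateGrowth := by
      fun_prop
    have h2 : (fun ξ : EuclideanSpace ℝ (Fin n) =>
      ((((2 * π) ^ 2 * ‖ξ‖ ^ 2 : ℝ) : ℂ))).HasTemperateGrowth :=
      Function.Complex.hasTemperateGrowth_ofReal.comp h1
    exact (h2.sub (.const _)).mul (.const _)
  have hm := hA.mul hB'
  refine (?_ : resolventSymbol n z = _) ▸ hm
  funext ξ
  have hY2 : ‖Y ξ‖ ^ 2 = (c₁ * ‖ξ‖ ^ 2) ^ 2 + c₂ ^ 2 * ‖ξ‖ ^ 2 := by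
    rw [WithLp.prod_norm_sq_eq_of_L2]
    simp [Y, norm_smul, mul_pow]
  have hc2 : c₂ ^ 2 = 2 * (-z.re) * (2 * π) ^ 2 / ‖z‖ ^ 2 := by
    simp only [c₂]
    rw [div_pow, mul_pow, Real.sq_sqrt (by linarith)]
  set s : ℝ := (2 * π) ^ 2 * ‖ξ‖ ^ 2 with hs
  have hs0 : 0 ≤ s := by positivity
  have hne := add_norm_sq_sub_ne_zero hz hs0
  have h3 : ‖(s : ℂ) - z‖ ^ 2 = ‖z‖ ^ 2 * (1 + ‖Y ξ‖ ^ 2) := by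
    rw [hY2, hc2]
    simp only [c₁]
    have e1 : ‖(s : ℂ) - z‖ ^ 2 = s ^ 2 - 2 * z.re * s + ‖z‖ ^ 2 := by
      rw [← Complex.normSq_eq_norm_sq, ← Complex.normSq_eq_norm_sq]
      simp [Complex.normSq_apply]
      ring
    rw [e1, hs]
    field_simp
    ring
  have h4 : (starRingEnd ℂ) ((s : ℂ) - z) = (s : ℂ) - starRingEnd ℂ z := by simp
  change ((s : ℂ) - z)⁻¹ = (((s : ℂ) - (starRingEnd ℂ z)) * (((‖z‖ ^ 2)⁻¹ : ℝ) : ℂ)) *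
    (((1 + ‖Y ξ‖ ^ 2) ^ (-1 : ℝ) : ℝ) : ℂ)
  rw [Complex.inv_def, h4, Complex.normSq_eq_norm_sq, h3, Real.rpow_neg_one, mul_inv]
  push_cast
  ring

theorem neg_laplacian_sub_resolvent {z : ℂ} (hz : z.re < 0)
    (φ : 𝓢(EuclideanSpace ℝ (Fin n), ℂ)) (x : EuclideanSpace ℝ (Fin n)) :
    -(Δ (fourierMultiplierCLM ℂ (resolventSymbol n z) φ :
        EuclideanSpace ℝ (Fin n) → ℂ) x)
      - z * fourierMultiplierCLM ℂ (resolventSymbol n z) φ x = φ x := by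
  have hm := hasTemperateGrowth_resolventSymbol (n := n) hz
  have hs : (fun ξ : EuclideanSpace ℝ (Fin n) => ‖ξ‖ ^ 2).HasTemperateGrowth := by fun_prop
  have hs' : (fun ξ : EuclideanSpace ℝ (Fin n) => ((‖ξ‖ ^ 2 : ℝ) : ℂ)).HasTemperateGrowth :=
    Function.Complex.hasTemperateGrowth_ofReal.comp hs
  -- The Laplacian is a multiplier with real symbol; it is cast to a complex one so that it composes
  -- with the resolvent symbol.
  have h1 : ∀ g : 𝓢(EuclideanSpace ℝ (Fin n), ℂ),
      fourierMultiplierCLM ℂ (fun ξ : EuclideanSpace ℝ (Fin n) => ((‖ξ‖ ^ 2 : ℝ) : ℂ)) g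
        = fourierMultiplierCLM ℂ (fun ξ : EuclideanSpace ℝ (Fin n) => ‖ξ‖ ^ 2) g :=
    fourierMultiplierCLM_ofReal ℂ hs
  rw [← SchwartzMap.laplacian_apply, SchwartzMap.laplacian_eq_fourierMultiplierCLM,
    ← h1, fourierMultiplierCLM_fourierMultiplierCLM_apply hs' hm]
  have e : ((2 * π) ^ 2 : ℝ) • fourierMultiplierCLM ℂ
        ((fun ξ : EuclideanSpace ℝ (Fin n) => ((‖ξ‖ ^ 2 : ℝ) : ℂ)) * resolventSymbol n z) φ
      - z • fourierMultiplierCLM ℂ (resolventSymbol n z) φ = φ := by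
    rw [fourierMultiplierCLM_apply, fourierMultiplierCLM_apply, ← FourierTransform.fourierInv_smul,
      ← FourierTransform.fourierInv_smul]
    refine (map_sub (FourierTransform.fourierInvCLM ℂ 𝓢(EuclideanSpace ℝ (Fin n), ℂ)) _ _).symm.trans
      ?_
    rw [FourierTransform.fourierInvCLM_apply]
    conv_rhs => rw [← FourierTransform.fourierInv_fourier_eq (F := 𝓢(EuclideanSpace ℝ (Fin n), ℂ)) φ]
    congr 1
    ext ξ
    have hne := add_norm_sq_sub_ne_zero hz (c := (2 * π) ^ 2 * ‖ξ‖ ^ 2) (by positivity)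
    simp only [_root_.sub_apply, _root_.smul_apply,
      SchwartzMap.smulLeftCLM_apply_apply (hs'.mul hm), SchwartzMap.smulLeftCLM_apply_apply hm]
    simp only [Pi.mul_apply, smul_eq_mul, Complex.real_smul, resolventSymbol]
    rw [← mul_assoc, ← mul_assoc, ← mul_assoc, ← sub_mul, ← sub_mul, ← Complex.ofReal_mul,
      mul_inv_cancel₀ hne, one_mul]
  have e' := congrArg (fun g : 𝓢(EuclideanSpace ℝ (Fin n), ℂ) => g x) e
  simp only [_root_.sub_apply, _root_.smul_apply, smul_eq_mul] at e'
  rw [← e']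
  simp [neg_smul]

/-- The Fourier transform is moved from `φ` onto the modulated Gaussian, whose transform is the heat
kernel centred at `x`. -/
theorem fourierInv_gaussian_mul_fourier {t : ℝ} (ht : 0 < t)
    (φ : 𝓢(EuclideanSpace ℝ (Fin n), ℂ)) (x : EuclideanSpace ℝ (Fin n)) :
    ∫ ξ, (Complex.exp (-((2 * π) ^ 2 * t : ℝ) * ‖ξ‖ ^ 2 + 2 * π * Complex.I * inner ℝ x ξ))
        * 𝓕 φ ξ
      = ∫ y, (gaussK 1 t (y - x) : ℂ) * φ y := by
  set b : ℂ := (((2 * π) ^ 2 * t : ℝ) : ℂ) with hb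
  have hb0 : 0 < b.re := by
    rw [hb, Complex.ofReal_re]
    positivity
  have hint : Integrable fun ξ : EuclideanSpace ℝ (Fin n) =>
      Complex.exp (-b * ‖ξ‖ ^ 2 + 2 * π * Complex.I * inner ℝ x ξ) :=
    GaussianFourier.integrable_cexp_neg_mul_sq_norm_add hb0 _ _
  have h := VectorFourier.integral_fourierIntegral_smul_eq_flip (L := innerₗ _)
    Real.continuous_fourierChar continuous_inner hint (φ.integrable (μ := volume))
  rw [flip_innerₗ] at h
  refine Eq.trans ?_ (h.symm.trans ?_)
  · rfl
  · refine integral_congr_ae (Filter.Eventually.of_forall fun y => ?_)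
    have hF := fourier_gaussian_innerProductSpace' hb0 x y
    change 𝓕 (fun v => Complex.exp (-b * ‖v‖ ^ 2 + 2 * π * Complex.I * inner ℝ x v)) y • φ y = _
    rw [hF, smul_eq_mul, finrank_euclideanSpace_fin]
    dsimp only
    congr 1
    unfold gaussK
    have e1 : (π / b : ℂ) = (((4 * π * t)⁻¹ : ℝ) : ℂ) := by
      rw [hb]
      push_cast
      have : (π : ℂ) ≠ 0 := by exact_mod_cast Real.pi_ne_zero
      have : (t : ℂ) ≠ 0 := by exact_mod_cast ht.ne'
      field_simp
      norm_num
    have e2 : (-π ^ 2 * ‖x - y‖ ^ 2 / b : ℂ)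
        = ((-(1 * ‖y - x‖ ^ 2 / (4 * t)) : ℝ) : ℂ) := by
      rw [hb, norm_sub_rev]
      push_cast
      have : (π : ℂ) ≠ 0 := by exact_mod_cast Real.pi_ne_zero
      have : (t : ℂ) ≠ 0 := by exact_mod_cast ht.ne'
      field_simp
      norm_num
    have e3 : ((n : ℂ) / 2) = (((n : ℝ) / 2 : ℝ) : ℂ) := by push_cast; rfl
    rw [e1, e2, e3, ← Complex.ofReal_cpow (by positivity), ← Complex.ofReal_exp,
      ← Complex.ofReal_mul, Real.inv_rpow (by positivity), ← Real.rpow_neg (by positivity), neg_div]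

/-- The symbol is `∫₀^∞ exp (-(s - z)t) dt` with `s = (2π)²‖ξ‖²`. After Fubini the `ξ`-integral is
`exp (zt)` times the heat flow of `φ`, and absolute values may be taken under the time integral
because the heat kernel is nonnegative. -/
theorem enorm_resolvent_le {z : ℂ} (hz : z.re < 0)
    (φ : 𝓢(EuclideanSpace ℝ (Fin n), ℂ)) (x : EuclideanSpace ℝ (Fin n)) :
    ‖fourierMultiplierCLM ℂ (resolventSymbol n z) φ x‖ₑ
      ≤ ∫⁻ y, ‖φ y‖ₑ * resK (-z.re) 1 (y - x) := by
  have hm := hasTemperateGrowth_resolventSymbol (n := n) hz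
  set F : EuclideanSpace ℝ (Fin n) → ℝ → ℂ := fun ξ t =>
    Complex.exp (z * t) * (Complex.exp (-((2 * π) ^ 2 * t : ℝ) * ‖ξ‖ ^ 2 +
      2 * π * Complex.I * inner ℝ x ξ) * 𝓕 φ ξ) with hF
  have e1 : fourierMultiplierCLM ℂ (resolventSymbol n z) φ x
      = ∫ ξ, ∫ t in Set.Ioi (0 : ℝ), F ξ t := by
    rw [fourierMultiplierCLM_apply, SchwartzMap.fourierInv_coe, Real.fourierInv_eq']
    refine integral_congr_ae (Filter.Eventually.of_forall fun ξ => ?_)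
    dsimp only
    rw [SchwartzMap.smulLeftCLM_apply_apply hm]
    have hre : (-((((2 * π) ^ 2 * ‖ξ‖ ^ 2 : ℝ) : ℂ) - z)).re < 0 := by
      have : 0 ≤ (2 * π) ^ 2 * ‖ξ‖ ^ 2 := by positivity
      simp only [Complex.neg_re, Complex.sub_re, Complex.ofReal_re]
      linarith
    have hI := integral_exp_mul_complex_Ioi hre 0
    rw [Complex.ofReal_zero, mul_zero, Complex.exp_zero, neg_div_neg_eq, one_div] at hI
    have e2 : ∀ t : ℝ, F ξ t = Complex.exp (-((((2 * π) ^ 2 * ‖ξ‖ ^ 2 : ℝ) : ℂ) - z) * t) *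
        (Complex.exp (((2 * π * inner ℝ ξ x : ℝ) : ℂ) * Complex.I) * 𝓕 φ ξ) := by
      intro t
      simp only [hF]
      rw [← mul_assoc, ← mul_assoc, ← Complex.exp_add, ← Complex.exp_add, real_inner_comm]
      congr 2
      push_cast
      ring
    simp_rw [e2]
    rw [integral_mul_const, hI]
    simp only [smul_eq_mul, resolventSymbol]
    ring
  have hnorm : ∀ ξ t, ‖F ξ t‖ = ‖𝓕 φ ξ‖ * (Real.exp (z.re * t) *
      Real.exp (-((2 * π) ^ 2 * t * ‖ξ‖ ^ 2))) := by
    intro ξ t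
    simp only [hF]
    rw [norm_mul, norm_mul, Complex.norm_exp, Complex.norm_exp]
    have h1 : (z * (t : ℂ)).re = z.re * t := by simp
    have h2 : (-(((2 * π) ^ 2 * t : ℝ) : ℂ) * (‖ξ‖ : ℂ) ^ 2 +
        2 * π * Complex.I * ((inner ℝ x ξ : ℝ) : ℂ)).re = -((2 * π) ^ 2 * t * ‖ξ‖ ^ 2) := by
      have h3 : -(((2 * π) ^ 2 * t : ℝ) : ℂ) * (‖ξ‖ : ℂ) ^ 2 +
          2 * π * Complex.I * ((inner ℝ x ξ : ℝ) : ℂ) = ((-((2 * π) ^ 2 * t * ‖ξ‖ ^ 2) : ℝ) : ℂ)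
            + ((2 * π * inner ℝ x ξ : ℝ) : ℂ) * Complex.I := by
        push_cast
        ring
      rw [h3, Complex.add_re, Complex.ofReal_re, Complex.re_ofReal_mul, Complex.I_re, mul_zero,
        add_zero]
    rw [h1, h2]
    ring
  -- Dropping the Gaussian factor, which is at most `1`, leaves the product majorant `|𝓕 φ ξ| exp
  -- (Re z t)`.
  have hFint : Integrable (Function.uncurry F)
      (volume.prod (volume.restrict (Set.Ioi (0 : ℝ)))) := by
    have hg : Integrable (fun p : EuclideanSpace ℝ (Fin n) × ℝ => 𝓕 φ p.1 *
        (Real.exp (z.re * p.2) : ℂ)) (volume.prod (volume.restrict (Set.Ioi (0 : ℝ)))) :=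
      Integrable.mul_prod (𝓕 φ).integrable (integrableOn_exp_mul_Ioi hz 0).ofReal
    refine hg.mono ?_ ?_
    · have hc : Continuous (Function.uncurry F) := by
        have := (𝓕 φ).continuous
        simp only [hF, Function.uncurry_def]
        fun_prop
      exact hc.aestronglyMeasurable
    · have hpos : ∀ᵐ p ∂((volume : Measure (EuclideanSpace ℝ (Fin n))).prod
          (volume.restrict (Set.Ioi (0 : ℝ)))), 0 < p.2 :=
        Measure.quasiMeasurePreserving_snd.ae (ae_restrict_mem measurableSet_Ioi)
      filter_upwards [hpos] with p hp
      rw [Function.uncurry_def, hnorm, norm_mul, Complex.norm_real, Real.norm_eq_abs,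
        abs_of_pos (Real.exp_pos _)]
      gcongr
      refine mul_le_of_le_one_right (Real.exp_pos _).le (Real.exp_le_one_iff.2 ?_)
      have : 0 ≤ (2 * π) ^ 2 * p.2 * ‖p.1‖ ^ 2 := by positivity
      linarith
  rw [e1, integral_integral_swap hFint, lintegral_mul_resK (by fun_prop)]
  refine (enorm_integral_le_lintegral_enorm _).trans ?_
  refine setLIntegral_mono' measurableSet_Ioi fun t ht => ?_
  have ht : 0 < t := ht
  simp only [hF]
  rw [integral_const_mul, fourierInv_gaussian_mul_fourier ht, enorm_mul]
  gcongr
  · rw [← ofReal_norm, Complex.norm_exp]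
    simp
  · refine (enorm_integral_le_lintegral_enorm _).trans (le_of_eq ?_)
    refine lintegral_congr fun y => ?_
    rw [enorm_mul, mul_comm, ← ofReal_norm ((gaussK 1 t (y - x) : ℝ) : ℂ), Complex.norm_real,
      Real.norm_of_nonneg (gaussK_nonneg ht _)]

end Fourier

/-! ### From compactly supported test functions to Schwartz functions -/

section Cutoff

open SchwartzMap Filter Topology

variable {n : ℕ}

/-- Smooth cutoff functions, equal to `1` on larger and larger balls. -/
noncomputable def cutoff (n k : ℕ) (x : EuclideanSpace ℝ (Fin n)) : ℝ :=
  (default : ContDiffBump (0 : EuclideanSpace ℝ (Fin n))) (((k : ℝ) + 1)⁻¹ • x)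

theorem contDiff_cutoff (k : ℕ) : ContDiff ℝ ∞ (cutoff n k) :=
  (default : ContDiffBump (0 : EuclideanSpace ℝ (Fin n))).contDiff.comp (contDiff_const_smul _)

theorem hasCompactSupport_cutoff (k : ℕ) : HasCompactSupport (cutoff n k) := by
  have h : ((k : ℝ) + 1)⁻¹ ≠ 0 := by positivity
  exact (default : ContDiffBump (0 : EuclideanSpace ℝ (Fin n))).hasCompactSupport.comp_smul h

theorem cutoff_eventuallyEq_one (x : EuclideanSpace ℝ (Fin n)) :
    ∀ᶠ k : ℕ in atTop, cutoff n k =ᶠ[𝓝 x] fun _ => 1 := by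
  obtain ⟨K, hK⟩ := exists_nat_gt ‖x‖
  filter_upwards [eventually_ge_atTop K] with k hk
  have hx : x ∈ Metric.ball (0 : EuclideanSpace ℝ (Fin n)) (k + 1) := by
    rw [mem_ball_zero_iff]
    have : (K : ℝ) ≤ k := by exact_mod_cast hk
    linarith
  filter_upwards [Metric.isOpen_ball.mem_nhds hx] with y hy
  refine ContDiffBump.one_of_mem_closedBall _ ?_
  rw [mem_closedBall_zero_iff, norm_smul, norm_inv, Real.norm_of_nonneg (by positivity)]
  rw [mem_ball_zero_iff] at hy
  change _ ≤ (1 : ℝ)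
  rw [inv_mul_le_iff₀ (by positivity)]
  linarith

/-- Each derivative of the rescaled bump picks up a factor `1/(k + 1) ≤ 1`, so the bound for `k = 0`
serves all `k`. -/
theorem exists_norm_iteratedFDeriv_cutoff_le (i : ℕ) :
    ∃ C : ℝ, 0 ≤ C ∧ ∀ k x, ‖iteratedFDeriv ℝ i (cutoff n k) x‖ ≤ C := by
  set B := (default : ContDiffBump (0 : EuclideanSpace ℝ (Fin n)))
  have hB : ContDiff ℝ ∞ B := B.contDiff
  have hc : Continuous (iteratedFDeriv ℝ i B) :=
    hB.continuous_iteratedFDeriv (m := i) (mod_cast le_top)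
  obtain ⟨C, hC⟩ := hc.bounded_above_of_compact_support (B.hasCompactSupport.iteratedFDeriv i)
  have hC0 : 0 ≤ C := (norm_nonneg _).trans (hC 0)
  refine ⟨C, hC0, fun k x => ?_⟩
  set L : EuclideanSpace ℝ (Fin n) →L[ℝ] EuclideanSpace ℝ (Fin n) :=
    ((k : ℝ) + 1)⁻¹ • ContinuousLinearMap.id ℝ _
  have hL : ‖L‖ ≤ 1 := by
    refine ContinuousLinearMap.opNorm_le_bound _ zero_le_one fun y => ?_
    have h1 : ((k : ℝ) + 1)⁻¹ ≤ 1 := inv_le_one_of_one_le₀ (by linarith [k.cast_nonneg (α := ℝ)])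
    simp only [L, _root_.smul_apply, ContinuousLinearMap.id_apply, norm_smul, norm_inv]
    rw [Real.norm_of_nonneg (by positivity)]
    gcongr
  have h : iteratedFDeriv ℝ i (cutoff n k) x
      = (iteratedFDeriv ℝ i B (L x)).compContinuousLinearMap fun _ => L :=
    L.iteratedFDeriv_comp_right hB x (mod_cast le_top)
  rw [h]
  refine (ContinuousMultilinearMap.norm_compContinuousLinearMap_le _ _).trans ?_
  calc ‖iteratedFDeriv ℝ i B (L x)‖ * ∏ _j : Fin i, ‖L‖
      ≤ C * ∏ _j : Fin i, 1 := by gcongr; exact hC _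
    _ = C := by simp

theorem norm_laplacian_le (g : EuclideanSpace ℝ (Fin n) → ℂ) (x : EuclideanSpace ℝ (Fin n)) :
    ‖Δ g x‖ ≤ n * ‖iteratedFDeriv ℝ 2 g x‖ := by
  rw [InnerProductSpace.laplacian_eq_iteratedFDeriv_orthonormalBasis g
    (EuclideanSpace.basisFun (Fin n) ℝ)]
  refine (norm_sum_le _ _).trans ?_
  refine (Finset.sum_le_card_nsmul _ _ ‖iteratedFDeriv ℝ 2 g x‖ fun i _ => ?_).trans ?_
  · refine (ContinuousMultilinearMap.le_opNorm _ _).trans ?_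
    simp [Fin.prod_univ_two]
  · simp

theorem exists_norm_iteratedFDeriv_schwartz_le (ψ : 𝓢(EuclideanSpace ℝ (Fin n), ℂ))
    (m j : ℕ) : ∃ D : ℝ, 0 ≤ D ∧ ∀ x,
      ‖iteratedFDeriv ℝ j ψ x‖ ≤ D * polyWeight n m 1 x := by
  refine ⟨2 ^ m * (Finset.Iic (m, j)).sup
    (fun m => SchwartzMap.seminorm ℝ m.1 m.2) ψ, by positivity, fun x => ?_⟩
  have h := one_add_le_sup_seminorm_apply (𝕜 := ℝ) (m := (m, j)) le_rfl le_rfl ψ x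
  unfold polyWeight
  rw [one_mul, ← div_eq_mul_inv, le_div_iff₀ (by positivity), mul_comm]
  exact h

/-- In the Leibniz formula the cutoff contributes bounded factors and `ψ` all the decay. Uniformity
in `k` provides the majorant for dominated convergence. -/
theorem exists_norm_iteratedFDeriv_cutoff_smul_le (ψ : 𝓢(EuclideanSpace ℝ (Fin n), ℂ))
    (m i : ℕ) : ∃ C : ℝ, 0 ≤ C ∧ ∀ k x,
      ‖iteratedFDeriv ℝ i (fun y => cutoff n k y • ψ y) x‖ ≤ C * polyWeight n m 1 x := by
  choose A hA0 hA using fun j => exists_norm_iteratedFDeriv_cutoff_le (n := n) j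
  choose D hD0 hD using exists_norm_iteratedFDeriv_schwartz_le ψ m
  refine ⟨∑ j ∈ Finset.range (i + 1), (i.choose j : ℝ) * A j * D (i - j),
    Finset.sum_nonneg fun j _ => by have := hA0 j; have := hD0 (i - j); positivity, fun k x => ?_⟩
  refine (norm_iteratedFDeriv_smul_le (contDiff_cutoff (n := n) k) (ψ.smooth ⊤) x
    (n := i) (mod_cast le_top)).trans ?_
  rw [Finset.sum_mul]
  refine Finset.sum_le_sum fun j _ => ?_
  rw [mul_assoc _ (D (i - j))]
  have := hA0 j
  have := hA j k x
  have := hD (i - j) x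
  gcongr

theorem integrable_mul_schwartz {v : EuclideanSpace ℝ (Fin n) → ℂ} {m : ℕ}
    (hv : AEStronglyMeasurable v) (hvw : Integrable fun x => ‖v x‖ * polyWeight n m 1 x)
    (ψ : 𝓢(EuclideanSpace ℝ (Fin n), ℂ)) : Integrable fun x => v x * ψ x := by
  obtain ⟨D, -, hD⟩ := exists_norm_iteratedFDeriv_schwartz_le ψ m 0
  refine (hvw.const_mul D).mono' (hv.mul ψ.continuous.aestronglyMeasurable)
    (Eventually.of_forall fun x => ?_)
  have := hD x
  rw [norm_iteratedFDeriv_zero] at this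
  rw [norm_mul]
  calc ‖v x‖ * ‖ψ x‖ ≤ ‖v x‖ * (D * polyWeight n m 1 x) := by gcongr
    _ = _ := by ring

theorem tendsto_integral_mul_of_eventually_eq {v : EuclideanSpace ℝ (Fin n) → ℂ} {m : ℕ}
    (hv : AEStronglyMeasurable v) (hvw : Integrable fun x => ‖v x‖ * polyWeight n m 1 x)
    {g : ℕ → EuclideanSpace ℝ (Fin n) → ℂ} {g₀ : EuclideanSpace ℝ (Fin n) → ℂ}
    (hg : ∀ k, Continuous (g k)) {C : ℝ} (hgC : ∀ k x, ‖g k x‖ ≤ C * polyWeight n m 1 x)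
    (hlim : ∀ x, ∀ᶠ k in atTop, g k x = g₀ x) :
    Tendsto (fun k => ∫ x, v x * g k x) atTop (𝓝 (∫ x, v x * g₀ x)) := by
  refine tendsto_integral_of_dominated_convergence
    (fun x => C * (‖v x‖ * polyWeight n m 1 x))
    (fun k => hv.mul (hg k).aestronglyMeasurable) (hvw.const_mul C) (fun k => ?_) ?_
  · refine Eventually.of_forall fun x => ?_
    rw [norm_mul]
    have := hgC k x
    calc ‖v x‖ * ‖g k x‖ ≤ ‖v x‖ * (C * polyWeight n m 1 x) := by gcongr
      _ = _ := by ring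
  · refine Eventually.of_forall fun x => ?_
    refine tendsto_const_nhds.congr' ?_
    filter_upwards [hlim x] with k hk
    rw [hk]

/-- The weak Schrödinger equation may be tested against Schwartz functions when all functions
involved are integrable against a polynomial weight. -/
theorem IsWeakSchrodinger.apply_schwartz {a b u f : EuclideanSpace ℝ (Fin n) → ℂ}
    (h : IsWeakSchrodinger a b u f) {m : ℕ}
    (hu : AEStronglyMeasurable u) (hf : AEStronglyMeasurable f)
    (huw : Integrable fun x => ‖u x‖ * polyWeight n m 1 x)
    (hfw : Integrable fun x => ‖f x‖ * polyWeight n m 1 x)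
    (hVw : Integrable fun x => ‖a x * (b x * u x)‖ * polyWeight n m 1 x)
    (ψ : 𝓢(EuclideanSpace ℝ (Fin n), ℂ)) :
    -(∫ x, u x * Δ (ψ : EuclideanSpace ℝ (Fin n) → ℂ) x) + ∫ x, (a x * (b x * u x)) * ψ x
      = ∫ x, f x * ψ x := by
  set g : ℕ → EuclideanSpace ℝ (Fin n) → ℂ := fun k y => cutoff n k y • ψ y
  have hgs : ∀ k, ContDiff ℝ ∞ (g k) := fun k => (contDiff_cutoff k).smul (ψ.smooth ⊤)
  have hgc : ∀ k, HasCompactSupport (g k) := fun k => (hasCompactSupport_cutoff k).smul_right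
  obtain ⟨C₀, -, hC₀⟩ := exists_norm_iteratedFDeriv_cutoff_smul_le ψ m 0
  obtain ⟨C₂, -, hC₂⟩ := exists_norm_iteratedFDeriv_cutoff_smul_le ψ m 2
  have hb₀ : ∀ k x, ‖g k x‖ ≤ C₀ * polyWeight n m 1 x := fun k x => by
    rw [← norm_iteratedFDeriv_zero (𝕜 := ℝ)]
    exact hC₀ k x
  have hb₂ : ∀ k x, ‖Δ (g k) x‖ ≤ (n * C₂) * polyWeight n m 1 x := fun k x => by
    rw [mul_assoc]
    exact (norm_laplacian_le _ _).trans (by gcongr; exact hC₂ k x)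
  -- Agreement on a neighbourhood, not just at `x`, is needed for the Laplacians to agree.
  have hl : ∀ x, ∀ᶠ k in atTop, g k =ᶠ[𝓝 x] ψ := fun x => by
    filter_upwards [cutoff_eventuallyEq_one x] with k hk
    filter_upwards [hk] with y hy
    simp [g, hy]
  have t₁ := tendsto_integral_mul_of_eventually_eq hu huw
    (fun k => continuous_laplacian_test (hgs k)) hb₂
    (g₀ := Δ (ψ : EuclideanSpace ℝ (Fin n) → ℂ)) (fun x => (hl x).mono fun k hk =>
      (InnerProductSpace.laplacian_congr_nhds hk).eq_of_nhds)
  have hl₀ : ∀ x, ∀ᶠ k in atTop, g k x = ψ x := fun x => (hl x).mono fun k hk => hk.eq_of_nhds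
  have t₂ := tendsto_integral_mul_of_eventually_eq h.1.aestronglyMeasurable hVw
    (fun k => (hgs k).continuous) hb₀ hl₀
  have t₃ := tendsto_integral_mul_of_eventually_eq hf hfw (fun k => (hgs k).continuous) hb₀ hl₀
  refine tendsto_nhds_unique (t₁.neg.add t₂) (t₃.congr fun k => ?_)
  exact (h.2 (g k) (hgs k) (hgc k)).symm

end Cutoff

/-! ### Weighted integrability and domination almost everywhere -/

section Domination

open SchwartzMap Filter Topology

variable {n : ℕ}

theorem lintegral_polyWeight_lt_top {m : ℕ} (hm : n < m) :
    ∫⁻ x, ENNReal.ofReal (polyWeight n m 1 x) < ⊤ := by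
  have h := integrable_one_add_norm (E := EuclideanSpace ℝ (Fin n)) (μ := volume) (r := m)
    (by rw [finrank_euclideanSpace_fin]; exact_mod_cast hm)
  refine lt_of_le_of_lt (lintegral_mono fun x => ?_) h.lintegral_lt_top
  refine ENNReal.ofReal_le_ofReal (le_of_eq ?_)
  rw [polyWeight, one_mul, Real.rpow_neg (by positivity), Real.rpow_natCast]

theorem measurable_ofReal_polyWeight (m : ℕ) {δ : ℝ} (hδ : 0 ≤ δ) :
    Measurable fun x => ENNReal.ofReal (polyWeight n m δ x) :=
  (continuous_polyWeight m hδ).measurable.ennreal_ofReal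

theorem polyWeight_le_one {m : ℕ} {δ : ℝ} (hδ : 0 ≤ δ) (x : EuclideanSpace ℝ (Fin n)) :
    polyWeight n m δ x ≤ 1 := by
  unfold polyWeight
  refine inv_le_one_of_one_le₀ (one_le_pow₀ ?_)
  have : 0 ≤ δ * ‖x‖ := by positivity
  linarith

/-- A function with finite Stummel quantity is integrable against polynomial weights. -/
theorem lintegral_rpow_mul_polyWeight_lt_top_of_stummelM (hn : 1 ≤ n) {ν s : ℝ}
    {a : EuclideanSpace ℝ (Fin n) → ℂ}
    (ha : AEStronglyMeasurable a volume) (hM : stummelM ν s a < ⊤) {m : ℕ} (hm : n < m) :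
    ∫⁻ y, ‖a y‖ₑ ^ s * ENNReal.ofReal (polyWeight n m 1 y) < ⊤ := by
  have : Nonempty (Fin n) := ⟨⟨0, hn⟩⟩
  set k : EuclideanSpace ℝ (Fin n) → ℝ≥0∞ :=
    (Metric.ball 0 1).indicator fun z => ‖z‖ₑ ^ (ν - n) with hk
  have hkm : Measurable k := Measurable.indicator (by fun_prop) measurableSet_ball
  have hk2 : Measurable fun p : EuclideanSpace ℝ (Fin n) × EuclideanSpace ℝ (Fin n) =>
      k (p.1 - p.2) := hkm.comp (measurable_fst.sub measurable_snd)
  have hpw := measurable_ofReal_polyWeight (n := n) m zero_le_one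
  have ham : AEMeasurable fun y => ‖a y‖ₑ ^ s := ha.enorm.pow_const s
  -- Only positivity of this integral matters: it is cancelled at the end, and the value `∞` does no
  -- harm.
  have hc : ∫⁻ z, k z ≠ 0 := by
    refine ((lintegral_pos_iff_support hkm).2 ?_).ne'
    have hsub : Metric.ball (0 : EuclideanSpace ℝ (Fin n)) 1 \ {0} ⊆ Function.support k := by
      rintro z ⟨hz, hz0⟩
      rw [Function.mem_support, hk, Set.indicator_of_mem hz]
      exact (ENNReal.rpow_pos (enorm_pos.2 hz0) enorm_ne_top).ne'
    refine lt_of_lt_of_le ?_ (measure_mono hsub)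
    rw [measure_sdiff_null (measure_singleton _)]
    exact Metric.measure_ball_pos _ _ one_pos
  have hball : ∀ x, ∫⁻ y, ‖a y‖ₑ ^ s * k (x - y) ≤ stummelM ν s a := by
    intro x
    refine le_trans (le_of_eq ?_) (le_iSup _ x)
    rw [← lintegral_indicator measurableSet_ball]
    refine lintegral_congr fun y => ?_
    by_cases hy : y ∈ Metric.ball x 1
    · have hy' : x - y ∈ Metric.ball (0 : EuclideanSpace ℝ (Fin n)) 1 := by
        rwa [mem_ball_zero_iff, ← dist_eq_norm, dist_comm, ← Metric.mem_ball]
      rw [Set.indicator_of_mem hy, hk, Set.indicator_of_mem hy']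
    · have hy' : x - y ∉ Metric.ball (0 : EuclideanSpace ℝ (Fin n)) 1 := by
        rwa [mem_ball_zero_iff, ← dist_eq_norm, dist_comm, ← Metric.mem_ball]
      rw [Set.indicator_of_notMem hy, hk, Set.indicator_of_notMem hy', mul_zero]
  -- Averaging over translates by Tonelli's theorem: where `k (x - y)` is nonzero, `‖x - y‖ < 1` and
  -- the weight moves from `y` to `x` at the cost of `exp m`. The inner integral is then at most the
  -- Stummel quantity.
  have main : (∫⁻ y, ‖a y‖ₑ ^ s * ENNReal.ofReal (polyWeight n m 1 y)) * ∫⁻ z, k z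
      ≤ ENNReal.ofReal (Real.exp m) *
        (stummelM ν s a * ∫⁻ x, ENNReal.ofReal (polyWeight n m 1 x)) := by
    calc (∫⁻ y, ‖a y‖ₑ ^ s * ENNReal.ofReal (polyWeight n m 1 y)) * ∫⁻ z, k z
        = ∫⁻ y, ∫⁻ x, ‖a y‖ₑ ^ s * ENNReal.ofReal (polyWeight n m 1 y) * k (x - y) := by
          have h0 : AEMeasurable fun y => ‖a y‖ₑ ^ s * ENNReal.ofReal (polyWeight n m 1 y) :=
            ham.mul hpw.aemeasurable
          rw [← lintegral_mul_const'' _ h0]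
          refine lintegral_congr fun y => ?_
          have hky : Measurable fun x => k (x - y) := hkm.comp (measurable_id.sub_const y)
          rw [lintegral_const_mul _ hky, lintegral_sub_right_eq_self k y]
      _ = ∫⁻ x, ∫⁻ y, ‖a y‖ₑ ^ s * ENNReal.ofReal (polyWeight n m 1 y) * k (x - y) := by
          refine lintegral_lintegral_swap ?_
          refine ((ham.mul hpw.aemeasurable).comp_fst).mul ?_
          exact (hkm.comp (measurable_snd.sub measurable_fst)).aemeasurable
      _ ≤ ∫⁻ x, ∫⁻ y, ENNReal.ofReal (Real.exp m) * ENNReal.ofReal (polyWeight n m 1 x) *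
            (‖a y‖ₑ ^ s * k (x - y)) := by
          refine lintegral_mono fun x => lintegral_mono fun y => ?_
          dsimp only
          by_cases hy : x - y ∈ Metric.ball (0 : EuclideanSpace ℝ (Fin n)) 1
          · have h1 : ENNReal.ofReal (polyWeight n m 1 y) ≤
                ENNReal.ofReal (Real.exp m) * ENNReal.ofReal (polyWeight n m 1 x) := by
              rw [← ENNReal.ofReal_mul (Real.exp_pos _).le]
              refine ENNReal.ofReal_le_ofReal ?_
              refine (polyWeight_le_exp_mul zero_le_one y x).trans ?_
              have := (polyWeight_pos (n := n) (m := m) zero_le_one x).le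
              gcongr
              rw [mem_ball_zero_iff, norm_sub_rev] at hy
              rw [mul_one]
              exact mul_le_of_le_one_right (by positivity) hy.le
            calc _ ≤ ‖a y‖ₑ ^ s * (ENNReal.ofReal (Real.exp m) *
                  ENNReal.ofReal (polyWeight n m 1 x)) * k (x - y) := by gcongr
              _ = _ := by ring
          · rw [hk, Set.indicator_of_notMem hy]
            simp
      _ = ∫⁻ x, ENNReal.ofReal (Real.exp m) * ENNReal.ofReal (polyWeight n m 1 x) *
            ∫⁻ y, ‖a y‖ₑ ^ s * k (x - y) := by
          refine lintegral_congr fun x => ?_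
          rw [lintegral_const_mul'']
          exact ham.mul (hk2.comp measurable_prodMk_left).aemeasurable
      _ ≤ ∫⁻ x, ENNReal.ofReal (Real.exp m) * ENNReal.ofReal (polyWeight n m 1 x) *
            stummelM ν s a := by
          refine lintegral_mono fun x => ?_
          dsimp only
          gcongr
          exact hball x
      _ = _ := by
          rw [lintegral_mul_const _ (hpw.const_mul _), lintegral_const_mul _ hpw]
          ring
  have hfin : ENNReal.ofReal (Real.exp m) *
        (stummelM ν s a * ∫⁻ x, ENNReal.ofReal (polyWeight n m 1 x)) < ⊤ :=
    ENNReal.mul_lt_top ENNReal.ofReal_lt_top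
      (ENNReal.mul_lt_top hM (lintegral_polyWeight_lt_top hm))
  by_contra hI
  rw [not_lt, top_le_iff] at hI
  rw [hI, ENNReal.top_mul hc] at main
  exact (lt_of_le_of_lt main hfin).ne rfl

/-- Young's inequality splits `|gv|` into `|g|^{p'}`, integrable with the weight, and `|v|^p`,
integrable without it. The cases of interest are `g = a`, `v = bu` and `g = 1`, `v = u`. -/
theorem lintegral_mul_polyWeight_lt_top {p : ℝ} (hp : 1 < p) {m : ℕ}
    {g v : EuclideanSpace ℝ (Fin n) → ℂ} (hg : AEStronglyMeasurable g volume)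
    (hgw : ∫⁻ y, ‖g y‖ₑ ^ (p / (p - 1)) * ENNReal.ofReal (polyWeight n m 1 y) < ⊤)
    (hv : MemLp v (ENNReal.ofReal p) volume) :
    ∫⁻ y, ‖g y * v y‖ₑ * ENNReal.ofReal (polyWeight n m 1 y) < ⊤ := by
  have hp0 : 0 < p := by linarith
  have hc : (p / (p - 1)).HolderConjugate p := (Real.HolderConjugate.conjExponent hp).symm
  have hvp : ∫⁻ y, ‖v y‖ₑ ^ p < ⊤ := by
    have := lintegral_rpow_enorm_lt_top_of_eLpNorm_lt_top (by simpa using hp0)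
      ENNReal.ofReal_ne_top hv.2
    rwa [ENNReal.toReal_ofReal hp0.le] at this
  refine lt_of_le_of_lt ?_ (ENNReal.add_lt_top.2 ⟨hgw, hvp⟩)
  have hpw := measurable_ofReal_polyWeight (n := n) m zero_le_one
  have h0 : AEMeasurable fun y =>
      ‖g y‖ₑ ^ (p / (p - 1)) * ENNReal.ofReal (polyWeight n m 1 y) :=
    (hg.enorm.pow_const _).mul hpw.aemeasurable
  rw [← lintegral_add_left' h0]
  refine lintegral_mono fun y => ?_
  dsimp only
  have h1 : ENNReal.ofReal (polyWeight n m 1 y) ≤ 1 := by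
    rw [← ENNReal.ofReal_one]
    exact ENNReal.ofReal_le_ofReal (polyWeight_le_one zero_le_one y)
  have hdiv : ∀ (A : ℝ≥0∞) {t : ℝ}, 1 ≤ t → A / ENNReal.ofReal t ≤ A := fun A t ht =>
    ENNReal.div_le_of_le_mul (le_mul_of_one_le_right' (by simpa using ht))
  have h2 : ‖g y * v y‖ₑ ≤ ‖g y‖ₑ ^ (p / (p - 1)) + ‖v y‖ₑ ^ p := by
    rw [enorm_mul]
    refine (ENNReal.young_inequality _ _ hc).trans ?_
    exact add_le_add (hdiv _ hc.lt.le) (hdiv _ hp.le)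
  calc _ ≤ (‖g y‖ₑ ^ (p / (p - 1)) + ‖v y‖ₑ ^ p) * ENNReal.ofReal (polyWeight n m 1 y) := by
        gcongr
    _ = ‖g y‖ₑ ^ (p / (p - 1)) * ENNReal.ofReal (polyWeight n m 1 y) +
        ‖v y‖ₑ ^ p * ENNReal.ofReal (polyWeight n m 1 y) := add_mul _ _ _
    _ ≤ _ := by
        gcongr
        exact mul_le_of_le_one_right' h1

theorem integrable_norm_mul_polyWeight {v : EuclideanSpace ℝ (Fin n) → ℂ}
    (hv : AEStronglyMeasurable v volume) {m : ℕ}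
    (h : ∫⁻ y, ‖v y‖ₑ * ENNReal.ofReal (polyWeight n m 1 y) < ⊤) :
    Integrable fun x => ‖v x‖ * polyWeight n m 1 x := by
  refine ⟨hv.norm.mul (continuous_polyWeight m zero_le_one).aestronglyMeasurable, ?_⟩
  refine lt_of_le_of_lt (lintegral_mono fun x => ?_) h
  rw [enorm_mul, enorm_norm]
  gcongr
  rw [Real.enorm_eq_ofReal (polyWeight_pos zero_le_one x).le]

/-- A locally integrable function that is dominated by `h` when tested against test functions is
dominated by `h` almost everywhere. -/
theorem enorm_le_ae_of_forall_test {u : EuclideanSpace ℝ (Fin n) → ℂ}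
    (hu : LocallyIntegrable u) {h : EuclideanSpace ℝ (Fin n) → ℝ≥0∞} (hhm : AEMeasurable h)
    {m : ℕ} (hh : ∫⁻ y, h y * ENNReal.ofReal (polyWeight n m 1 y) < ⊤)
    (H : ∀ φ : EuclideanSpace ℝ (Fin n) → ℂ, ContDiff ℝ ∞ φ → HasCompactSupport φ →
      ‖∫ x, u x * φ x‖ₑ ≤ ∫⁻ x, ‖φ x‖ₑ * h x) :
    ∀ᵐ x, ‖u x‖ₑ ≤ h x := by
  have hpw := measurable_ofReal_polyWeight (n := n) m zero_le_one
  have hfin : ∀ᵐ x, h x < ⊤ := by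
    filter_upwards [ae_lt_top' (hhm.mul hpw.aemeasurable) hh.ne] with x hx
    by_contra hc
    rw [not_lt, top_le_iff] at hc
    rw [Pi.mul_apply, hc, ENNReal.top_mul] at hx
    · exact hx.ne rfl
    · exact (ENNReal.ofReal_pos.2 (polyWeight_pos zero_le_one x)).ne'
  have hloc : LocallyIntegrable fun x => (h x).toReal := by
    have h1 : Integrable fun x => (h x).toReal * polyWeight n m 1 x := by
      have := integrable_toReal_of_lintegral_ne_top (hhm.mul hpw.aemeasurable) hh.ne
      refine this.congr (Eventually.of_forall fun x => ?_)
      simp only [Pi.mul_apply]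
      rw [ENNReal.toReal_mul, ENNReal.toReal_ofReal (polyWeight_pos zero_le_one x).le]
    -- Dividing by the weight is multiplication by a continuous function, which preserves local
    -- integrability.
    have h2 : LocallyIntegrable fun x => ((h x).toReal * polyWeight n m 1 x) *
        (polyWeight n m 1 x)⁻¹ := by
      have hcont : Continuous fun x => (polyWeight n m 1 x)⁻¹ :=
        (continuous_polyWeight m zero_le_one).inv₀ fun x => (polyWeight_pos zero_le_one x).ne'
      exact h1.locallyIntegrable.mul_continuous hcont
    refine h2.congr (Eventually.of_forall fun x => ?_)
    exact mul_inv_cancel_right₀ (polyWeight_pos zero_le_one x).ne' _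
  -- Shrinking bumps with a fixed ratio `2` of radii: Lebesgue differentiation makes the
  -- mollifications of `u` and `h` converge almost everywhere, and the hypothesis compares them at
  -- each stage.
  let B : ℕ → ContDiffBump (0 : EuclideanSpace ℝ (Fin n)) := fun k =>
    ⟨((k : ℝ) + 1)⁻¹ / 2, ((k : ℝ) + 1)⁻¹, by positivity, half_lt_self (by positivity)⟩
  have hB : Tendsto (fun k => (B k).rOut) atTop (𝓝 0) := by
    simpa [B] using tendsto_one_div_add_atTop_nhds_zero_nat (𝕜 := ℝ)
  have hB' : ∀ᶠ k in atTop, (B k).rOut ≤ 2 * (B k).rIn :=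
    Eventually.of_forall fun k => by simp only [B]; linarith
  filter_upwards [ContDiffBump.ae_convolution_tendsto_right_of_locallyIntegrable hB hB' hu,
    ContDiffBump.ae_convolution_tendsto_right_of_locallyIntegrable hB hB' hloc, hfin]
    with x hx₁ hx₂ hx₃
  rw [← ofReal_norm, ← ENNReal.ofReal_toReal hx₃.ne]
  refine ENNReal.ofReal_le_ofReal ?_
  refine le_of_tendsto_of_tendsto hx₁.norm hx₂ (Eventually.of_forall fun k => ?_)
  simp only [convolution_eq_swap, ContinuousLinearMap.lsmul_apply]
  set φ : EuclideanSpace ℝ (Fin n) → ℝ := fun y => (B k).normed volume (x - y) with hφ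
  have hφs : ContDiff ℝ ∞ φ := (B k).contDiff_normed.comp (contDiff_const.sub contDiff_id)
  have hφc : HasCompactSupport φ :=
    (B k).hasCompactSupport_normed.comp_homeomorph (Homeomorph.subLeft x)
  have hφ0 : ∀ y, 0 ≤ φ y := fun y => (B k).nonneg_normed _
  have hφC : ContDiff ℝ ∞ fun y => (φ y : ℂ) := Complex.ofRealCLM.contDiff.comp hφs
  have hφCc : HasCompactSupport fun y => (φ y : ℂ) :=
    hφc.comp_left (g := fun t : ℝ => (t : ℂ)) (by simp)
  have key := H _ hφC hφCc
  have hint : Integrable fun y => φ y • (h y).toReal :=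
    hloc.integrable_smul_left_of_hasCompactSupport hφs.continuous hφc
  have e1 : ∫⁻ y, ‖(φ y : ℂ)‖ₑ * h y = ENNReal.ofReal (∫ y, φ y • (h y).toReal) := by
    rw [ofReal_integral_eq_lintegral_ofReal hint
      (Eventually.of_forall fun y => mul_nonneg (hφ0 y) ENNReal.toReal_nonneg)]
    refine lintegral_congr_ae ?_
    filter_upwards [hfin] with y hy
    rw [smul_eq_mul, ENNReal.ofReal_mul (hφ0 y), ENNReal.ofReal_toReal hy.ne, ← ofReal_norm,
      Complex.norm_real, Real.norm_of_nonneg (hφ0 y)]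
  have hpos : 0 ≤ ∫ y, φ y • (h y).toReal :=
    integral_nonneg fun y => smul_nonneg (hφ0 y) ENNReal.toReal_nonneg
  rw [e1, ← ofReal_norm, ENNReal.ofReal_le_ofReal_iff hpos] at key
  refine le_trans (le_of_eq ?_) key
  congr 1
  refine integral_congr_ae (Eventually.of_forall fun y => ?_)
  simp only [Complex.real_smul]
  ring

end Domination

/-! ### Pointwise domination of eigenfunctions and the weighted `L¹` inequality -/

section Eigenfunction

open SchwartzMap Filter Topology

variable {n : ℕ}

theorem lintegral_mul_polyWeight_mul_lt_top {m : ℕ} {δ : ℝ} (hδ : 0 < δ) (hδ1 : δ ≤ 1)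
    {f : EuclideanSpace ℝ (Fin n) → ℝ≥0∞}
    (hf : ∫⁻ y, f y * ENNReal.ofReal (polyWeight n m 1 y) < ⊤) :
    ∫⁻ y, f y * ENNReal.ofReal (polyWeight n m δ y) < ⊤ := by
  refine lt_of_le_of_lt ?_ (ENNReal.mul_lt_top (ENNReal.ofReal_lt_top (r := (δ ^ m)⁻¹)) hf)
  rw [← lintegral_const_mul' _ _ ENNReal.ofReal_ne_top]
  refine lintegral_mono fun y => ?_
  dsimp only
  calc f y * ENNReal.ofReal (polyWeight n m δ y)
      ≤ f y * ENNReal.ofReal ((δ ^ m)⁻¹ * polyWeight n m 1 y) := by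
        gcongr
        exact polyWeight_le_mul hδ hδ1 y
    _ = _ := by
        rw [ENNReal.ofReal_mul (by positivity)]
        ring

/-- The choice `δ = η/(m + 1)` gives `mδ ≤ η`; the `+ 1` also covers `m = 0`. -/
theorem ofReal_polyWeight_le_exp_mul {m : ℕ} {η : ℝ} (hη : 0 < η)
    (x y : EuclideanSpace ℝ (Fin n)) :
    ENNReal.ofReal (polyWeight n m (η / (m + 1)) x) ≤
      ENNReal.ofReal (Real.exp (η * ‖x - y‖)) * ENNReal.ofReal (polyWeight n m (η / (m + 1)) y) := by
  have hδ : 0 ≤ η / (m + 1) := by positivity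
  rw [← ENNReal.ofReal_mul (Real.exp_pos _).le]
  refine ENNReal.ofReal_le_ofReal ((polyWeight_le_exp_mul hδ x y).trans ?_)
  have := (polyWeight_pos (n := n) (m := m) hδ y).le
  gcongr
  rw [mul_div_left_comm]
  refine mul_le_of_le_one_right hη.le ?_
  rw [div_le_one (by positivity)]
  linarith

theorem aemeasurable_resK_conv {κ σ : ℝ} {f : EuclideanSpace ℝ (Fin n) → ℝ≥0∞}
    (hf : AEMeasurable f) : AEMeasurable fun x => ∫⁻ y, resK κ σ (x - y) * f y := by
  have h : AEMeasurable (fun p : EuclideanSpace ℝ (Fin n) × EuclideanSpace ℝ (Fin n) =>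
      resK κ σ (p.1 - p.2) * f p.2) (volume.prod volume) :=
    ((measurable_resK κ σ).comp (measurable_fst.sub measurable_snd)).aemeasurable.mul hf.comp_snd
  exact h.lintegral_prod_right'

theorem lintegral_resK_conv_mul_polyWeight_lt_top {κ : ℝ} (hκ : 0 < κ) {m : ℕ}
    {f : EuclideanSpace ℝ (Fin n) → ℝ≥0∞} (hf : AEMeasurable f)
    (hfw : ∫⁻ y, f y * ENNReal.ofReal (polyWeight n m 1 y) < ⊤) :
    ∫⁻ x, (∫⁻ y, resK κ 1 (x - y) * f y) * ENNReal.ofReal (polyWeight n m 1 x) < ⊤ := by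
  -- Any `η` below both `1` and `κ` works; both parameters `κ - η` and `1 - η` of the modified
  -- kernel must be positive.
  set η := min 1 κ / 2 with hη
  have hmin : 0 < min 1 κ := lt_min one_pos hκ
  have hη0 : 0 < η := by positivity
  have h1 : min 1 κ ≤ 1 := min_le_left _ _
  have h2 : min 1 κ ≤ κ := min_le_right _ _
  have hη1 : η < 1 := by linarith
  have hηκ : η < κ := by linarith
  set δ := η / ((m : ℝ) + 1) with hδ
  have hδ0 : 0 < δ := by positivity
  have hδ1 : δ ≤ 1 := by
    refine (div_le_self hη0.le ?_).trans hη1.le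
    linarith [m.cast_nonneg (α := ℝ)]
  have hw := measurable_ofReal_polyWeight (n := n) m hδ0.le
  have key := lintegral_mul_weight_resK_le (n := n) (κ := κ) hη0 (g := fun _ => 1)
    aemeasurable_const hf hw (ofReal_polyWeight_le_exp_mul hη0) (fun y => by
      simp only [one_mul]
      rw [lintegral_resK (sub_pos.2 hηκ) (sub_pos.2 hη1)])
  simp only [one_mul] at key
  refine lt_of_le_of_lt (lintegral_mono fun x => ?_) (lt_of_le_of_lt key
    (ENNReal.mul_lt_top ENNReal.ofReal_lt_top (lintegral_mul_polyWeight_mul_lt_top hδ0 hδ1 hfw)))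
  dsimp only
  rw [mul_comm]
  gcongr
  unfold polyWeight
  gcongr

/-- An eigenfunction `u` for `z` satisfies `|u| ≤ (-Δ - Re z)⁻¹ |q u|`. -/
theorem IsWeakSchrodinger.enorm_le_resK_conv {a b u : EuclideanSpace ℝ (Fin n) → ℂ} {z : ℂ}
    (hz : z.re < 0) (h : IsWeakSchrodinger a b u (fun x => z * u x))
    (hu : LocallyIntegrable u) {m : ℕ}
    (huw : ∫⁻ y, ‖u y‖ₑ * ENNReal.ofReal (polyWeight n m 1 y) < ⊤)
    (hVw : ∫⁻ y, ‖a y * (b y * u y)‖ₑ * ENNReal.ofReal (polyWeight n m 1 y) < ⊤) :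
    ∀ᵐ x, ‖u x‖ₑ ≤ ∫⁻ y, resK (-z.re) 1 (x - y) * ‖a y * (b y * u y)‖ₑ := by
  have hVm := h.1.aestronglyMeasurable
  have hum := hu.aestronglyMeasurable
  have hV := integrable_norm_mul_polyWeight hVm hVw
  have hU := integrable_norm_mul_polyWeight hum huw
  have hzU : Integrable fun x => ‖z * u x‖ * polyWeight n m 1 x := by
    refine (hU.const_mul ‖z‖).congr (Eventually.of_forall fun x => ?_)
    simp only [norm_mul]
    ring
  refine enorm_le_ae_of_forall_test hu (aemeasurable_resK_conv hVm.enorm)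
    (lintegral_resK_conv_mul_polyWeight_lt_top (by linarith) hVm.enorm hVw) fun φ hφ hφc => ?_
  set φS : 𝓢(EuclideanSpace ℝ (Fin n), ℂ) := hφc.toSchwartzMap hφ
  -- The equation is tested against `ψ = (-Δ - z)⁻¹ φ`, which is Schwartz but in general not
  -- compactly supported; this turns `∫ uφ` into `-∫ (qu)ψ`.
  set ψ := fourierMultiplierCLM ℂ (resolventSymbol n z) φS with hψ
  have e1 := h.apply_schwartz hum (hum.const_mul z) hU hzU hV ψ
  have e2 : ∀ x, φ x = -(Δ ψ : 𝓢(EuclideanSpace ℝ (Fin n), ℂ)) x - z * ψ x := fun x => by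
    rw [SchwartzMap.laplacian_apply, hψ, neg_laplacian_sub_resolvent hz φS x]
    rfl
  have i1 := integrable_mul_schwartz hum hU (Δ ψ : 𝓢(EuclideanSpace ℝ (Fin n), ℂ))
  have i2 := integrable_mul_schwartz (hum.const_mul z) hzU ψ
  have e3 : ∫ x, u x * φ x = -∫ x, (a x * (b x * u x)) * ψ x := by
    have e4 : ∀ x, u x * φ x
        = -(u x * (Δ ψ : 𝓢(EuclideanSpace ℝ (Fin n), ℂ)) x) - z * u x * ψ x := fun x => by
      rw [e2 x]
      ring
    simp_rw [e4]
    have i1' : Integrable fun x => -(u x * (Δ ψ : 𝓢(EuclideanSpace ℝ (Fin n), ℂ)) x) := i1.neg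
    rw [integral_sub i1' i2, integral_neg, ← e1]
    simp_rw [SchwartzMap.laplacian_apply]
    ring
  rw [e3, enorm_neg]
  have hm2 : Measurable fun p : EuclideanSpace ℝ (Fin n) × EuclideanSpace ℝ (Fin n) =>
      ‖φ p.2‖ₑ * resK (-z.re) 1 (p.2 - p.1) :=
    (hφ.continuous.measurable.enorm.comp measurable_snd).mul
      ((measurable_resK _ _).comp (measurable_snd.sub measurable_fst))
  calc ‖∫ x, (a x * (b x * u x)) * ψ x‖ₑ
      ≤ ∫⁻ x, ‖a x * (b x * u x)‖ₑ * ∫⁻ y, ‖φ y‖ₑ * resK (-z.re) 1 (y - x) := by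
        refine (enorm_integral_le_lintegral_enorm _).trans (lintegral_mono fun x => ?_)
        rw [enorm_mul]
        gcongr
        exact enorm_resolvent_le hz φS x
    _ = ∫⁻ x, ∫⁻ y, ‖a x * (b x * u x)‖ₑ * (‖φ y‖ₑ * resK (-z.re) 1 (y - x)) := by
        refine lintegral_congr fun x => ?_
        exact (lintegral_const_mul _ (hm2.comp measurable_prodMk_left)).symm
    _ = ∫⁻ y, ∫⁻ x, ‖a x * (b x * u x)‖ₑ * (‖φ y‖ₑ * resK (-z.re) 1 (y - x)) :=
        lintegral_lintegral_swap (hVm.enorm.comp_fst.mul hm2.aemeasurable)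
    _ = ∫⁻ y, ‖φ y‖ₑ * ∫⁻ x, resK (-z.re) 1 (y - x) * ‖a x * (b x * u x)‖ₑ := by
        refine lintegral_congr fun y => ?_
        rw [← lintegral_const_mul' _ _ enorm_ne_top]
        refine lintegral_congr fun x => ?_
        ring

/-- The norm bound for multiplication by `q` after convolution with the resolvent kernel. -/
theorem one_le_rpow_mul_of_enorm_le_resK_conv {q u : EuclideanSpace ℝ (Fin n) → ℂ}
    {r κ η : ℝ} (hr : 1 ≤ r) (hnr : (n : ℝ) / (2 * r) < 1) (hη : 0 < η) (hη1 : η < 1) (hηκ : η < κ)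
    (hq : AEStronglyMeasurable q volume) (hum : AEStronglyMeasurable u volume)
    (hu0 : ¬ u =ᵐ[volume] 0)
    {m : ℕ} (hqw : ∫⁻ y, ‖q y * u y‖ₑ * ENNReal.ofReal (polyWeight n m 1 y) < ⊤)
    (hle : ∀ᵐ x, ‖u x‖ₑ ≤ ∫⁻ y, resK κ 1 (x - y) * ‖q y * u y‖ₑ) :
    1 ≤ (∫⁻ x, ‖q x‖ₑ ^ r) ^ (1 / r) *
        ENNReal.ofReal ((4 * Real.pi) ^ (-(n : ℝ) / (2 * r)) *
          ((r - 1) / (r * (1 - η))) ^ (n * (r - 1) / (2 * r)) *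
          (Real.Gamma (1 - n / (2 * r)) * (κ - η) ^ (-(1 - n / (2 * r))))) := by
  set K := (∫⁻ x, ‖q x‖ₑ ^ r) ^ (1 / r) *
        ENNReal.ofReal ((4 * Real.pi) ^ (-(n : ℝ) / (2 * r)) *
          ((r - 1) / (r * (1 - η))) ^ (n * (r - 1) / (2 * r)) *
          (Real.Gamma (1 - n / (2 * r)) * (κ - η) ^ (-(1 - n / (2 * r)))))
  set δ := η / ((m : ℝ) + 1) with hδ
  have hδ0 : 0 < δ := by positivity
  have hδ1 : δ ≤ 1 := by
    refine (div_le_self hη.le ?_).trans hη1.le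
    linarith [m.cast_nonneg (α := ℝ)]
  have hw := measurable_ofReal_polyWeight (n := n) m hδ0.le
  have hfm : AEMeasurable fun y => ‖q y * u y‖ₑ := (hq.mul hum).enorm
  have hfin := lintegral_mul_polyWeight_mul_lt_top hδ0 hδ1 hqw
  have key := lintegral_mul_weight_resK_le (n := n) (κ := κ) hη (g := fun x => ‖q x‖ₑ)
    hq.enorm hfm hw (ofReal_polyWeight_le_exp_mul hη)
    (lintegral_mul_resK_le hr hnr (sub_pos.2 hηκ) (sub_pos.2 hη1) hq.enorm)
  set I := ∫⁻ y, ‖q y * u y‖ₑ * ENNReal.ofReal (polyWeight n m δ y) with hI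
  -- The pointwise domination of `u`, multiplied by `|q|w` and integrated, reproduces `I` on both
  -- sides.
  have hIK : I ≤ K * I := by
    refine le_trans (lintegral_mono_ae ?_) key
    filter_upwards [hle] with x hx
    rw [enorm_mul]
    calc ‖q x‖ₑ * ‖u x‖ₑ * ENNReal.ofReal (polyWeight n m δ x)
        = ‖q x‖ₑ * ENNReal.ofReal (polyWeight n m δ x) * ‖u x‖ₑ := by ring
      _ ≤ _ := by gcongr
  -- If `qu` vanished almost everywhere, the domination would force `u = 0`.
  have hI0 : I ≠ 0 := by
    intro h0
    have h0 := (lintegral_eq_zero_iff' (hfm.mul hw.aemeasurable)).1 h0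
    have hf0 : ∀ᵐ y, ‖q y * u y‖ₑ = 0 := by
      filter_upwards [h0] with y hy
      rcases mul_eq_zero.1 (show ‖q y * u y‖ₑ * ENNReal.ofReal (polyWeight n m δ y) = 0 from hy) with
        hy | hy
      · exact hy
      · exact absurd hy (ENNReal.ofReal_pos.2 (polyWeight_pos hδ0.le y)).ne'
    refine hu0 ?_
    filter_upwards [hle] with x hx
    have : ∫⁻ y, resK κ 1 (x - y) * ‖q y * u y‖ₑ = 0 := by
      refine (lintegral_congr_ae (g := fun _ => 0) ?_).trans lintegral_zero
      filter_upwards [hf0] with y hy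
      rw [hy, mul_zero]
    rw [this] at hx
    simpa using hx
  by_contra hK
  rw [not_le] at hK
  have : K * I < 1 * I := (ENNReal.mul_lt_mul_iff_left hI0 hfin.ne).2 hK
  rw [one_mul] at this
  exact absurd hIK (not_le.2 this)

end Eigenfunction

/-! ### The limit of vanishing weight and the explicit constant -/

section Eigenvalue

open Filter Topology

variable {n : ℕ}

/-- The eigenvalue bound in terms of `κ = -Re z`. -/
theorem rpow_le_mul_integral_of_enorm_le_resK_conv {q u : EuclideanSpace ℝ (Fin n) → ℂ}
    {γ r κ : ℝ} (hγ : 0 < γ) (hr : r = γ + n / 2) (hr1 : 1 ≤ r) (hκ : 0 < κ)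
    (hq : MemLp q (ENNReal.ofReal r) volume) (hum : AEStronglyMeasurable u volume)
    (hu0 : ¬ u =ᵐ[volume] 0)
    {m : ℕ} (hqw : ∫⁻ y, ‖q y * u y‖ₑ * ENNReal.ofReal (polyWeight n m 1 y) < ⊤)
    (hle : ∀ᵐ x, ‖u x‖ₑ ≤ ∫⁻ y, resK κ 1 (x - y) * ‖q y * u y‖ₑ) :
    κ ^ γ ≤ (4 * Real.pi) ^ (-(n : ℝ) / 2) * ((r - 1) / r) ^ (n * (r - 1) / 2) *
      Real.Gamma (γ / r) ^ r * ∫ x, ‖q x‖ ^ r := by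
  have hr0 : 0 < r := by linarith
  have hr10 : 0 ≤ r - 1 := by linarith
  have hs : 1 - (n : ℝ) / (2 * r) = γ / r := by
    rw [hr]
    have : γ + (n : ℝ) / 2 ≠ 0 := hr ▸ hr0.ne'
    field_simp
    ring
  have hs0 : 0 < γ / r := by positivity
  have hnr : (n : ℝ) / (2 * r) < 1 := by linarith
  set J := ∫ x, ‖q x‖ ^ r with hJ
  have hJ0 : 0 ≤ J := integral_nonneg fun x => by positivity
  have hQ : ∫⁻ x, ‖q x‖ₑ ^ r = ENNReal.ofReal J := by
    have hint := hq.integrable_norm_rpow (by simpa using hr0) ENNReal.ofReal_ne_top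
    rw [ENNReal.toReal_ofReal hr0.le] at hint
    rw [hJ, ofReal_integral_eq_lintegral_ofReal hint
      (Eventually.of_forall fun x => by positivity)]
    refine lintegral_congr fun x => ?_
    rw [← ofReal_norm, ENNReal.ofReal_rpow_of_nonneg (norm_nonneg _) hr0.le]
  set A := (4 * Real.pi) ^ (-(n : ℝ) / (2 * r)) with hA
  set e := n * (r - 1) / (2 * r) with he
  have he0 : 0 ≤ e := by positivity
  have hΓ : 0 < Real.Gamma (γ / r) := Real.Gamma_pos_of_pos hs0
  set c : ℝ → ℝ := fun η => J ^ (1 / r) *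
    (A * ((r - 1) / (r * (1 - η))) ^ e * (Real.Gamma (γ / r) * (κ - η) ^ (-(γ / r)))) with hc
  -- The integral of `|q|^r` carries no weight, so only the kernel constants depend on `η` and the
  -- limit `η → 0` is elementary.
  have hc1 : ∀ᶠ η in 𝓝[>] (0 : ℝ), 1 ≤ c η := by
    filter_upwards [Ioo_mem_nhdsGT (lt_min one_pos hκ)] with η hη
    have h1 : η < 1 := hη.2.trans_le (min_le_left _ _)
    have h2 : η < κ := hη.2.trans_le (min_le_right _ _)
    have key := one_le_rpow_mul_of_enorm_le_resK_conv hr1 hnr hη.1 h1 h2 hq.1 hum hu0 hqw hle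
    have h3 : 0 < 1 - η := by linarith
    have h4 : 0 < κ - η := by linarith
    rw [hQ, hs, ENNReal.ofReal_rpow_of_nonneg hJ0 (by positivity),
      ← ENNReal.ofReal_mul (by positivity), ← ENNReal.ofReal_one,
      ENNReal.ofReal_le_ofReal_iff (by positivity)] at key
    exact key
  have hcont : Tendsto c (𝓝[>] 0) (𝓝 (c 0)) := by
    have h : ContinuousAt c 0 := by
      have g1 : ContinuousAt (fun η : ℝ => ((r - 1) / (r * (1 - η))) ^ e) 0 := by
        -- The base is `0` when `r = 1`, so continuity rests on the exponent being nonnegative.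
        refine ContinuousAt.rpow_const ?_ (Or.inr he0)
        refine ContinuousAt.div (by fun_prop) (by fun_prop) ?_
        simpa using hr0.ne'
      have g2 : ContinuousAt (fun η : ℝ => (κ - η) ^ (-(γ / r))) 0 :=
        ContinuousAt.rpow_const (by fun_prop) (Or.inl (by simpa using hκ.ne'))
      exact continuousAt_const.mul ((continuousAt_const.mul g1).mul (continuousAt_const.mul g2))
    exact h.tendsto.mono_left nhdsWithin_le_nhds
  have hlim : 1 ≤ c 0 := ge_of_tendsto hcont hc1
  simp only [hc, sub_zero, mul_one] at hlim
  have hb : 0 ≤ (r - 1) / r := by positivity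
  have hfin : κ ^ (γ / r) ≤ J ^ (1 / r) * (A * ((r - 1) / r) ^ e * Real.Gamma (γ / r)) := by
    rw [Real.rpow_neg hκ.le] at hlim
    have hp : 0 < κ ^ (γ / r) := by positivity
    calc κ ^ (γ / r) = κ ^ (γ / r) * 1 := (mul_one _).symm
      _ ≤ κ ^ (γ / r) * (J ^ (1 / r) * (A * ((r - 1) / r) ^ e *
            (Real.Gamma (γ / r) * (κ ^ (γ / r))⁻¹))) := by gcongr
      _ = _ := by field_simp
  have hpow := Real.rpow_le_rpow (by positivity) hfin hr0.le
  rw [← Real.rpow_mul hκ.le, div_mul_cancel₀ _ hr0.ne', Real.mul_rpow (by positivity) (by positivity),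
    Real.mul_rpow (by positivity) hΓ.le, Real.mul_rpow (by positivity) (by positivity),
    ← Real.rpow_mul hJ0, one_div_mul_cancel hr0.ne', Real.rpow_one, hA, ← Real.rpow_mul (by positivity),
    ← Real.rpow_mul hb] at hpow
  have x1 : -(n : ℝ) / (2 * r) * r = -(n : ℝ) / 2 := by field_simp
  have x2 : e * r = n * (r - 1) / 2 := by
    rw [he]
    field_simp
  rw [x1, x2] at hpow
  rw [mul_comm _ J]
  exact hpow

end Eigenvalue

/-! ### The eigenvalue estimate -/

theorem mainTheorem4 (n : ℕ) (hn : 1 ≤ n) (p : ℝ) (hp : 1 < p) (γ : ℝ)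
    (hγ_low : p ≤ n → 0 < γ) (hγ_high : (n : ℝ) < p → p - n ≤ 2 * γ)
    (hγ_two : 2 ≤ 2 * γ + n)
    (q a b : EuclideanSpace ℝ (Fin n) → ℂ)
    (hq : MemLp q (ENNReal.ofReal (γ + (n : ℝ) / 2)) volume)
    (ha : AEStronglyMeasurable a volume) (hb : AEStronglyMeasurable b volume)
    (hqab : q =ᵐ[volume] fun x => a x * b x)
    (ν μ : ℝ) (hν : 0 < ν) (hν' : ν < p / (p - 1)) (hμ : 0 < μ) (hμ' : μ < p)
    (hMa : stummelM ν (p / (p - 1)) a < ⊤) (hMb : stummelM μ p b < ⊤)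
    (z : ℂ) (hz : IsEigenvalue (schrodingerOp p hp a b) z) (hre : z.re < 0)
    (θ : ℝ) (hθ : θ ∈ Set.Ioo (-(Real.pi / 2)) (Real.pi / 2))
    (harg : z = (‖z‖ : ℂ) * Complex.exp (((Real.pi - θ : ℝ) : ℂ) * Complex.I)) :
    ‖z‖ ^ γ ≤ corConst n γ θ * ∫ x, ‖q x‖ ^ (γ + (n : ℝ) / 2) := by
  have hγ : 0 < γ := by
    rcases le_or_gt p n with h | h
    · exact hγ_low h
    · have := hγ_high h
      linarith
  set r := γ + (n : ℝ) / 2 with hr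
  have hr1 : 1 ≤ r := by linarith
  have hr0 : 0 < r := by linarith
  have hp0 : 0 < p := by linarith
  have hcos : 0 < Real.cos θ := Real.cos_pos_of_mem_Ioo hθ
  have hκ : -z.re = ‖z‖ * Real.cos θ := by
    have h := congrArg Complex.re harg
    rw [Complex.re_ofReal_mul, Complex.exp_ofReal_mul_I_re, Real.cos_pi_sub] at h
    linarith
  obtain ⟨⟨U, hU⟩, hU0, hTU⟩ := hz
  have hgraph : (U, z • U) ∈ schrodingerGraph p hp a b := by
    rw [← schrodingerOp_graph, LinearPMap.mem_graph_iff]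
    exact ⟨⟨U, hU⟩, rfl, hTU⟩
  obtain ⟨hbU, hweak⟩ := hgraph
  dsimp only at hbU hweak hU0
  set u := (U : EuclideanSpace ℝ (Fin n) → ℂ)
  have hzu : ((z • U : LpC n p) : EuclideanSpace ℝ (Fin n) → ℂ) =ᵐ[volume] fun x => z * u x := by
    filter_upwards [Lp.coeFn_smul z U] with x hx
    rw [hx, Pi.smul_apply, smul_eq_mul]
  have hweak' := hweak.congr (Filter.EventuallyEq.refl _ _) hzu
  have hup : MemLp u (ENNReal.ofReal p) volume := Lp.memLp U
  have hum : AEStronglyMeasurable u volume := hup.1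
  have hu0 : ¬ u =ᵐ[volume] 0 := fun h => hU0 ((Lp.eq_zero_iff_ae_eq_zero).2 h)
  -- The weight exponent `m = n + 1` is the least integer for which the weight itself is integrable.
  have hVw := lintegral_mul_polyWeight_lt_top hp ha
    (lintegral_rpow_mul_polyWeight_lt_top_of_stummelM hn ha hMa (Nat.lt_succ_self n)) hbU
  have huw := lintegral_mul_polyWeight_lt_top (m := n + 1) (g := fun _ => 1) hp
    aestronglyMeasurable_const
    (by simpa using lintegral_polyWeight_lt_top (Nat.lt_succ_self n)) hup
  simp only [one_mul] at huw
  have hle := hweak'.enorm_le_resK_conv hre (locallyIntegrable_LpC hp.le U) huw hVw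
  have hqV : (fun y => ‖a y * (b y * u y)‖ₑ) =ᵐ[volume] fun y => ‖q y * u y‖ₑ := by
    filter_upwards [hqab] with y hy
    rw [hy, mul_assoc]
  have hqw : ∫⁻ y, ‖q y * u y‖ₑ * ENNReal.ofReal (polyWeight n (n + 1) 1 y) < ⊤ := by
    refine lt_of_le_of_lt (le_of_eq (lintegral_congr_ae ?_)) hVw
    filter_upwards [hqV] with y hy
    rw [hy]
  have hle' : ∀ᵐ x, ‖u x‖ₑ ≤ ∫⁻ y, resK (-z.re) 1 (x - y) * ‖q y * u y‖ₑ := by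
    filter_upwards [hle] with x hx
    refine hx.trans (le_of_eq (lintegral_congr_ae ?_))
    filter_upwards [hqV] with y hy
    rw [hy]
  have key := rpow_le_mul_integral_of_enorm_le_resK_conv hγ hr hr1 (by linarith) hq hum hu0 hqw hle'
  rw [hκ, Real.mul_rpow (norm_nonneg _) hcos.le] at key
  set J := ∫ x, ‖q x‖ ^ r with hJ
  have hJ0 : 0 ≤ J := integral_nonneg fun x => by positivity
  have h2r : 2 * γ + (n : ℝ) = 2 * r := by rw [hr]; ring
  have c1 : (2 * γ + (n : ℝ) - 2) / (2 * γ + n) = (r - 1) / r := by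
    rw [h2r, show 2 * r - 2 = 2 * (r - 1) by ring, mul_div_mul_left _ _ two_ne_zero]
  have c2 : (n : ℝ) * (2 * γ + n - 2) / 4 = n * (r - 1) / 2 := by
    rw [h2r]
    ring
  have c3 : 2 * γ / (2 * γ + (n : ℝ)) = γ / r := by
    rw [h2r, mul_div_mul_left _ _ two_ne_zero]
  have hr10 : 0 ≤ r - 1 := by linarith
  have hΓ : 0 < Real.Gamma (γ / r) := Real.Gamma_pos_of_pos (by positivity)
  unfold corConst
  rw [c1, c2, c3, ← hr]
  have hcp : 0 < Real.cos θ ^ γ := Real.rpow_pos_of_pos hcos _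
  -- The argument yields the sharper factor `cos^{-γ} θ`; since `0 < cos θ ≤ 1` it is at most the
  -- stated `cos^{-2γ} θ`.
  have hcc : Real.cos θ ^ (2 * γ) ≤ Real.cos θ ^ γ :=
    Real.rpow_le_rpow_of_exponent_ge hcos (Real.cos_le_one θ) (by linarith)
  have hc2p : 0 < Real.cos θ ^ (2 * γ) := Real.rpow_pos_of_pos hcos _
  set D := ((r - 1) / r) ^ ((n : ℝ) * (r - 1) / 2) * Real.Gamma (γ / r) ^ r * J with hD
  have hD0 : 0 ≤ D := by positivity
  have hP : 0 < (4 * Real.pi) ^ ((n : ℝ) / 2) := by positivity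
  calc ‖z‖ ^ γ ≤ (4 * Real.pi) ^ (-(n : ℝ) / 2) * D / Real.cos θ ^ γ := by
        rw [le_div_iff₀ hcp]
        refine key.trans (le_of_eq ?_)
        rw [hD]
        ring
    _ ≤ (4 * Real.pi) ^ (-(n : ℝ) / 2) * D / Real.cos θ ^ (2 * γ) := by gcongr
    _ = _ := by
        rw [neg_div, Real.rpow_neg (by positivity), hD]
        field_simp
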